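/- Write $L^2=L^2_{\mathbb C}(0,1)$ and $L^2\times L^2$ for the Hilbert space with inner product the sum of the two component inner products. Put $S_0=\mathrm{Id}$ and, for $a\in\mathbb N=\{0,1,2,\dots\}$, let $S_{a+1}$ be the bounded operator of $L^2\times L^2$ given by $$S_{a+1}[p,q](x)=\Big(p(x)-2(2a+1)x^{2a}\int_x^1\frac{p(t)}{t^{2a+1}}\,dt,\; q(x)-2(2a+1)x^{2a+1}\int_x^1\frac{q(t)}{t^{2a+2}}\,dt\Big).$$ Let $T_0=-S_0$, $T_a=(-1)^{a+1}S_aS_{a-1}\cdots S_1$ for $a\ge 1$, and $N_k=\ker S_k^*$ for $k\ge1$. Let $j_n(z)=\sqrt{\pi z/2}\,J_{n+1/2}(z)$ and $\eta_n(z)=(-1)^n\sqrt{\pi z/2}\,J_{-n-1/2}(z)$ for integers $n\ge-1$, where $J_\nu$ is the Bessel function of the first kind, and $$\Phi_a=\begin{bmatrix}-2j_{a-1}j_a\\ j_a^2-j_{a-1}^2\end{bmatrix},\qquad \Psi_a=\begin{bmatrix}-\eta_{a-1}j_a-\eta_aj_{a-1}\\ -\eta_{a-1}j_{a-1}+\eta_aj_a\end{bmatrix},$$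 extended by continuity to $z=0$. Below, $\cdot$ is the bilinear (unconjugated) product of $\mathbb C^2$. Let $T_a^1,T_a^2$ be the operators of $L^2$ such that $T_a[f,g]=(T_a^1[f],T_a^2[g])$. Then for every $a\in\mathbb N$: (i) $T_a$ is a bounded, one-to-one operator on $L^2\times L^2$ such that for all $p,q\in L^2$ and all $\lambda\in\mathbb C$ $$\int_0^1\Phi_a(\lambda t)\cdot\begin{bmatrix}p(t)\\q(t)\end{bmatrix}dt=\int_0^1\begin{bmatrix}\sin(2\lambda t)\\ \cos(2\lambda t)\end{bmatrix}\cdot T_a[p,q](t)\,dt,$$ $$\int_0^1\Psi_a(\lambda t)\cdot\begin{bmatrix}p(t)\\q(t)\end{bmatrix}dt=\int_0^1\begin{bmatrix}\cos(2\lambda t)\\ -\sin(2\lambda t)\end{bmatrix}\cdot T_a[p,q](t)\,dt,$$ the integrands on the left being integrable. (ii) The adjoint is $T_a^*[f,g]=\big((T_a^1)^*[f],(T_a^2)^*[g]\big)$. For all $\lambda\in\mathbb C$, as elements of $L^2\times L^2$, $$\Phi_a(\lambda x)=T_a^*\begin{bmatrix}\sin(2\lambda x)\\ \cos(2\lambda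 x)\end{bmatrix},\qquad \Psi_a(\lambda x)=T_a^*\begin{bmatrix}\cos(2\lambda x)\\ -\sin(2\lambda x)\end{bmatrix},$$ and $\ker T_a^*=\bigoplus_{k=1}^aN_k$ (an internal direct sum, $\{0\}$ for $a=0$). (iii) $T_a$ is a linear isomorphism of $L^2\times L^2$ onto $\big(\bigoplus_{k=1}^aN_k\big)^\perp$, with bounded inverse. The inverse is the restriction to this subspace of the bounded operator $B_a$ on $L^2\times L^2$ defined by $B_a[f,g]=\big((T_a^2)^*[f],(T_a^1)^*[g]\big)$. -/

import Mathlib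

open MeasureTheory Set Filter Topology
open scoped ENNReal

namespace AKNS

noncomputable section

/-! ### The Hilbert spaces `L²(0,1)` and `L²(0,1) × L²(0,1)` -/

/-- Lebesgue measure on `(0,1)`. -/
abbrev μ01 : Measure ℝ := volume.restrict (Ioo (0:ℝ) 1)

/-- The complex Hilbert space `L²(0,1)`. -/
abbrev L2C : Type := Lp ℂ 2 μ01

/-- The Hilbert space `L²(0,1) × L²(0,1)`, with the sum of the two inner products. -/
abbrev H : Type := WithLp 2 (L2C × L2C)

/-- The element `(f, g)` of `L²(0,1) × L²(0,1)`. -/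
abbrev vec (f g : L2C) : H := WithLp.toLp 2 (f, g)

/-- The operator `(f, g) ↦ (A f, B g)`. -/
def diagOp (A B : L2C →L[ℂ] L2C) : H →L[ℂ] H :=
  (WithLp.prodContinuousLinearEquiv 2 ℂ L2C L2C).symm.toContinuousLinearMap ∘L
    (A.prodMap B) ∘L (WithLp.prodContinuousLinearEquiv 2 ℂ L2C L2C).toContinuousLinearMap

lemma diagOp_vec (A B : L2C →L[ℂ] L2C) (f g : L2C) : diagOp A B (vec f g) = vec (A f) (B g) := rfl

/-! ### A Hardy inequality, which makes the operators below well defined -/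

lemma tail_bound {x : ℝ} (hx : 0 < x) (hx1 : x < 1) :
    ∫⁻ t in Ioo x 1, ENNReal.ofReal (t ^ (-(3/2) : ℝ)) ≤ ENNReal.ofReal (2 * x ^ (-(1/2) : ℝ)) := by
  have hint : IntervalIntegrable (fun t : ℝ => t ^ (-(3/2) : ℝ)) volume x 1 :=
    intervalIntegral.intervalIntegrable_rpow (Or.inr (by
      rw [uIcc_of_le hx1.le]; intro h; exact absurd h.1 (not_le.2 hx)))
  have hion : IntegrableOn (fun t : ℝ => t ^ (-(3/2) : ℝ)) (Ioo x 1) :=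
    ((intervalIntegrable_iff_integrableOn_Ioc_of_le hx1.le).1 hint).mono_set Ioo_subset_Ioc_self
  rw [← ofReal_integral_eq_lintegral_ofReal hion]
  · apply ENNReal.ofReal_le_ofReal
    rw [← integral_Ioc_eq_integral_Ioo, ← intervalIntegral.integral_of_le hx1.le, integral_rpow]
    · norm_num
      linarith
    · right
      refine ⟨by norm_num, ?_⟩
      rw [uIcc_of_le hx1.le]; intro h; exact absurd h.1 (not_le.2 hx)
  · filter_upwards [ae_restrict_mem measurableSet_Ioo] with t ht
    exact Real.rpow_nonneg (hx.trans ht.1).le _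

lemma head_bound {t : ℝ} (ht : 0 < t) :
    ∫⁻ x in Ioo 0 t, ENNReal.ofReal (2 * x ^ (-(1/2) : ℝ)) ≤ ENNReal.ofReal (4 * t ^ ((1/2) : ℝ)) := by
  have hint : IntervalIntegrable (fun x : ℝ => 2 * x ^ (-(1/2) : ℝ)) volume 0 t :=
    (intervalIntegral.intervalIntegrable_rpow' (by norm_num)).const_mul 2
  have hion : IntegrableOn (fun x : ℝ => 2 * x ^ (-(1/2) : ℝ)) (Ioo 0 t) :=
    ((intervalIntegrable_iff_integrableOn_Ioc_of_le ht.le).1 hint).mono_set Ioo_subset_Ioc_self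
  rw [← ofReal_integral_eq_lintegral_ofReal hion]
  · apply ENNReal.ofReal_le_ofReal
    rw [← integral_Ioc_eq_integral_Ioo, ← intervalIntegral.integral_of_le ht.le,
      intervalIntegral.integral_const_mul, integral_rpow (Or.inl (by norm_num))]
    norm_num
    linarith
  · filter_upwards [ae_restrict_mem measurableSet_Ioo] with x hx
    have := Real.rpow_nonneg hx.1.le (-(1/2) : ℝ)
    positivity

lemma hardy (g : ℝ → ℝ≥0∞) (hg : Measurable g) :
    ∫⁻ x in Ioo (0:ℝ) 1, (∫⁻ t in Ioo x 1, g t * ENNReal.ofReal t⁻¹) ^ 2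
      ≤ 4 * ∫⁻ t in Ioo (0:ℝ) 1, g t ^ 2 := by
  have h1 : ∀ x ∈ Ioo (0:ℝ) 1, (∫⁻ t in Ioo x 1, g t * ENNReal.ofReal t⁻¹) ^ 2 ≤
      ∫⁻ t in Ioo (0:ℝ) 1, (Ioi x).indicator (fun t => g t ^ 2 * ENNReal.ofReal (t ^ (-(1/2) : ℝ))
        * ENNReal.ofReal (2 * x ^ (-(1/2) : ℝ))) t := by
    intro x hx
    have hcs := ENNReal.lintegral_mul_le_Lp_mul_Lq (volume.restrict (Ioo x 1))
      Real.HolderConjugate.two_two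
      (f := fun t => g t * ENNReal.ofReal (t ^ (-(1/4) : ℝ)))
      (g := fun t => ENNReal.ofReal (t ^ (-(3/4) : ℝ))) (by fun_prop) (by fun_prop)
    have he : ∫⁻ t in Ioo x 1, g t * ENNReal.ofReal t⁻¹ = ∫⁻ t in Ioo x 1,
        ((fun t => g t * ENNReal.ofReal (t ^ (-(1/4) : ℝ))) *
          (fun t => ENNReal.ofReal (t ^ (-(3/4) : ℝ)))) t := by
      refine setLIntegral_congr_fun measurableSet_Ioo fun t ht => ?_
      have ht0 : 0 < t := hx.1.trans ht.1
      simp only [Pi.mul_apply]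
      rw [mul_assoc, ← ENNReal.ofReal_mul (Real.rpow_nonneg ht0.le _), ← Real.rpow_add ht0]
      norm_num [Real.rpow_neg_one]
    rw [he]
    refine (pow_le_pow_left' hcs 2).trans ?_
    rw [mul_pow, ← ENNReal.rpow_natCast, ← ENNReal.rpow_mul, ← ENNReal.rpow_natCast,
      ← ENNReal.rpow_mul]
    norm_num only [Nat.cast_ofNat, ENNReal.rpow_one]
    have e1 : ∫⁻ t in Ioo (0:ℝ) 1, (Ioi x).indicator (fun t => g t ^ 2 *
        ENNReal.ofReal (t ^ (-(1/2) : ℝ)) * ENNReal.ofReal (2 * x ^ (-(1/2) : ℝ))) t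
        = (∫⁻ t in Ioo x 1, g t ^ 2 * ENNReal.ofReal (t ^ (-(1/2) : ℝ))) *
          ENNReal.ofReal (2 * x ^ (-(1/2) : ℝ)) := by
      rw [lintegral_indicator measurableSet_Ioi, Measure.restrict_restrict measurableSet_Ioi,
        lintegral_mul_const _ (by fun_prop)]
      have : Ioi x ∩ Ioo 0 1 = Ioo x 1 := by
        ext t; simp only [mem_inter_iff, mem_Ioi, mem_Ioo]
        exact ⟨fun h => ⟨h.1, h.2.2⟩, fun h => ⟨h.1, hx.1.trans h.1, h.2⟩⟩
      rw [this]
    rw [e1]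
    gcongr ?_ * ?_
    · refine le_of_eq (setLIntegral_congr_fun measurableSet_Ioo fun t ht => ?_)
      have ht0 : 0 < t := hx.1.trans ht.1
      rw [ENNReal.mul_rpow_of_nonneg _ _ (by norm_num), ENNReal.ofReal_rpow_of_pos
        (Real.rpow_pos_of_pos ht0 _), ← Real.rpow_mul ht0.le]
      norm_num
    · refine le_trans (le_of_eq (setLIntegral_congr_fun measurableSet_Ioo fun t ht => ?_))
        (tail_bound hx.1 hx.2)
      have ht0 : 0 < t := hx.1.trans ht.1
      rw [ENNReal.ofReal_rpow_of_pos (Real.rpow_pos_of_pos ht0 _), ← Real.rpow_mul ht0.le]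
      norm_num
  refine (setLIntegral_mono' measurableSet_Ioo h1).trans ?_
  rw [lintegral_lintegral_swap]
  · rw [← lintegral_const_mul _ (by fun_prop)]
    refine setLIntegral_mono' measurableSet_Ioo fun t ht => ?_
    have e2 : ∀ x : ℝ, (Ioi x).indicator (fun t => g t ^ 2 * ENNReal.ofReal (t ^ (-(1/2) : ℝ))
        * ENNReal.ofReal (2 * x ^ (-(1/2) : ℝ))) t = g t ^ 2 * ENNReal.ofReal (t ^ (-(1/2) : ℝ)) *
        (Iio t).indicator (fun x => ENNReal.ofReal (2 * x ^ (-(1/2) : ℝ))) x := by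
      intro x
      by_cases h : x < t <;> simp [indicator, h]
    simp_rw [e2]
    rw [lintegral_const_mul _ (Measurable.indicator (by fun_prop) measurableSet_Iio),
      lintegral_indicator measurableSet_Iio, Measure.restrict_restrict measurableSet_Iio]
    have : Iio t ∩ Ioo 0 1 = Ioo 0 t := by
      ext x; simp only [mem_inter_iff, mem_Iio, mem_Ioo]
      exact ⟨fun h => ⟨h.2.1, h.1⟩, fun h => ⟨h.2, h.1, h.2.trans ht.2⟩⟩
    rw [this]
    refine (mul_le_mul_right (head_bound ht.1) _).trans ?_
    rw [mul_assoc, ← ENNReal.ofReal_mul (Real.rpow_nonneg ht.1.le _), mul_left_comm,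
      ← Real.rpow_add ht.1]
    norm_num
    rw [mul_comm]
  · have hm : MeasurableSet {q : ℝ × ℝ | q.1 < q.2} := measurableSet_lt measurable_fst measurable_snd
    refine Measurable.aemeasurable ?_
    have : (Function.uncurry fun x t => (Ioi x).indicator (fun t => g t ^ 2 *
        ENNReal.ofReal (t ^ (-(1/2) : ℝ)) * ENNReal.ofReal (2 * x ^ (-(1/2) : ℝ))) t) =
        {q : ℝ × ℝ | q.1 < q.2}.indicator (fun q => g q.2 ^ 2 *
        ENNReal.ofReal (q.2 ^ (-(1/2) : ℝ)) * ENNReal.ofReal (2 * q.1 ^ (-(1/2) : ℝ))) := by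
      ext ⟨x, t⟩
      simp [Function.uncurry, indicator]
    rw [this]
    exact Measurable.indicator (by fun_prop) hm

/-- `x ↦ x ^ m * ∫_x^1 p(t) / t^(m+1) dt`. -/
def tailAverage (m : ℕ) (p : ℝ → ℂ) (x : ℝ) : ℂ :=
  (x : ℂ) ^ m * ∫ t in x..1, p t / (t : ℂ) ^ (m + 1)

lemma tail_eq {m : ℕ} {p : ℝ → ℂ} {x : ℝ} (hx : x < 1) :
    tailAverage m p x = (x : ℂ) ^ m * ∫ t in Ioo x 1, p t / (t : ℂ) ^ (m + 1) := by
  rw [tailAverage, intervalIntegral.integral_of_le hx.le, integral_Ioc_eq_integral_Ioo]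

lemma enorm_tail_le {m : ℕ} {p : ℝ → ℂ} {x : ℝ} (hx : x ∈ Ioo (0:ℝ) 1) :
    ‖tailAverage m p x‖ₑ ≤ ∫⁻ t in Ioo x 1, ‖p t‖ₑ * ENNReal.ofReal t⁻¹ := by
  rw [tail_eq hx.2, ← integral_const_mul]
  refine (enorm_integral_le_lintegral_enorm _).trans ?_
  refine setLIntegral_mono' measurableSet_Ioo fun t ht => ?_
  have ht0 : 0 < t := hx.1.trans ht.1
  have : (x : ℂ) ^ m * (p t / (t : ℂ) ^ (m + 1)) = p t * ((((x / t) ^ m * t⁻¹ : ℝ)) : ℂ) := by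
    push_cast
    have : (t : ℂ) ≠ 0 := by exact_mod_cast ht0.ne'
    rw [div_pow]
    field_simp
    ring
  rw [this, enorm_mul]
  gcongr
  have h0 : 0 ≤ (x / t) ^ m * t⁻¹ := by have := hx.1; positivity
  rw [← ofReal_norm, Complex.norm_real, Real.norm_of_nonneg h0]
  apply ENNReal.ofReal_le_ofReal
  have : (x / t) ^ m ≤ 1 := pow_le_one₀ (div_nonneg hx.1.le ht0.le) ((div_le_one ht0).2 ht.1.le)
  exact mul_le_of_le_one_left (by positivity) this

lemma tail_congr {m : ℕ} {p q : ℝ → ℂ} (h : p =ᵐ[μ01] q) {x : ℝ} (hx : x ∈ Ioo (0:ℝ) 1) :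
    tailAverage m p x = tailAverage m q x := by
  rw [tail_eq hx.2, tail_eq hx.2]
  congr 1
  refine integral_congr_ae ?_
  have : p =ᵐ[volume.restrict (Ioo x 1)] q :=
    ae_restrict_of_ae_restrict_of_subset (Ioo_subset_Ioo_left hx.1.le) h
  filter_upwards [this] with t ht
  rw [ht]

lemma tail_integrable {m : ℕ} {p : ℝ → ℂ} (hp : MemLp p 2 μ01) {x : ℝ} (hx : x ∈ Ioo (0:ℝ) 1) :
    IntegrableOn (fun t => p t / (t : ℂ) ^ (m + 1)) (Ioo x 1) := by
  have h1 : IntegrableOn p (Ioo x 1) :=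
    IntegrableOn.mono_set (hp.integrable (by norm_num)) (Ioo_subset_Ioo_left hx.1.le)
  simp_rw [div_eq_mul_inv]
  refine Integrable.mul_bdd (c := (x ^ (m + 1))⁻¹) h1 ?_ ?_
  · exact Measurable.aestronglyMeasurable (by fun_prop)
  · filter_upwards [ae_restrict_mem measurableSet_Ioo] with t ht
    rw [norm_inv, norm_pow, Complex.norm_real, Real.norm_of_nonneg (hx.1.trans ht.1).le]
    have := hx.1
    have := ht.1.le
    gcongr

lemma tail_add {m : ℕ} {p q : ℝ → ℂ} (hp : MemLp p 2 μ01) (hq : MemLp q 2 μ01) {x : ℝ}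
    (hx : x ∈ Ioo (0:ℝ) 1) :
    tailAverage m (p + q) x = tailAverage m p x + tailAverage m q x := by
  rw [tail_eq hx.2, tail_eq hx.2, tail_eq hx.2, ← mul_add,
    ← integral_add (tail_integrable hp hx) (tail_integrable hq hx)]
  simp only [Pi.add_apply, add_div]

lemma tail_smul {m : ℕ} (c : ℂ) (p : ℝ → ℂ) (x : ℝ) :
    tailAverage m (c • p) x = c * tailAverage m p x := by
  unfold tailAverage
  rw [mul_left_comm]
  simp only [Pi.smul_apply, smul_eq_mul, mul_div_assoc, intervalIntegral.integral_const_mul]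

lemma tail_aesm (m : ℕ) {p : ℝ → ℂ} (hp : StronglyMeasurable p) :
    AEStronglyMeasurable (tailAverage m p) μ01 := by
  have h : StronglyMeasurable fun x : ℝ => (x : ℂ) ^ m *
      ∫ t, (if x < t then p t / (t : ℂ) ^ (m + 1) else 0) ∂μ01 := by
    refine StronglyMeasurable.mul (Measurable.stronglyMeasurable (by fun_prop)) ?_
    refine StronglyMeasurable.integral_prod_right (f := fun x t : ℝ =>
      if x < t then p t / (t : ℂ) ^ (m + 1) else 0) ?_
    refine Measurable.stronglyMeasurable ?_
    have := hp.measurable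
    exact Measurable.ite (measurableSet_lt measurable_fst measurable_snd) (by fun_prop)
      (by fun_prop)
  refine h.aestronglyMeasurable.congr ?_
  filter_upwards [ae_restrict_mem measurableSet_Ioo] with x hx
  rw [tail_eq hx.2]
  congr 1
  have : (fun t : ℝ => if x < t then p t / (t : ℂ) ^ (m + 1) else 0) =
      (Ioi x).indicator fun t => p t / (t : ℂ) ^ (m + 1) := by
    ext t; simp [indicator]
  rw [this, integral_indicator measurableSet_Ioi, Measure.restrict_restrict measurableSet_Ioi]
  have : Ioi x ∩ Ioo 0 1 = Ioo x 1 := by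
    ext t; simp only [mem_inter_iff, mem_Ioi, mem_Ioo]
    exact ⟨fun h => ⟨h.1, h.2.2⟩, fun h => ⟨h.1, hx.1.trans h.1, h.2⟩⟩
  rw [this]

lemma tail_eLpNorm (m : ℕ) (p : L2C) :
    eLpNorm (tailAverage m p) 2 μ01 ≤ 2 * eLpNorm p 2 μ01 := by
  have hsq : eLpNorm (tailAverage m p) 2 μ01 ^ 2 ≤ (2 * eLpNorm p 2 μ01) ^ 2 := by
    rw [mul_pow]
    have e (f : ℝ → ℂ) : eLpNorm f 2 μ01 ^ 2 = ∫⁻ x in Ioo (0:ℝ) 1, ‖f x‖ₑ ^ 2 := by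
      have := eLpNorm_nnreal_pow_eq_lintegral (μ := μ01) (f := f) (p := 2) two_ne_zero
      have h3 : ((2 : NNReal) : ℝ) = ((2 : ℕ) : ℝ) := rfl
      rw [h3] at this
      simp only [ENNReal.rpow_natCast] at this
      exact this
    rw [e, e]
    refine (setLIntegral_mono' measurableSet_Ioo fun x hx =>
      pow_le_pow_left' (enorm_tail_le hx) 2).trans ?_
    refine (hardy (fun t => ‖p t‖ₑ) (Lp.stronglyMeasurable p).enorm).trans (le_of_eq ?_)
    norm_num
  exact (ENNReal.pow_le_pow_left_iff two_ne_zero).1 hsq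

lemma tail_memLp (m : ℕ) (p : L2C) : MemLp (tailAverage m p) 2 μ01 :=
  ⟨tail_aesm m (Lp.stronglyMeasurable p),
    (tail_eLpNorm m p).trans_lt (ENNReal.mul_lt_top (by norm_num) (Lp.memLp p).2)⟩

/-- `tailAverage m` as a bounded operator of `L²(0,1)`. -/
def tailOp (m : ℕ) : L2C →L[ℂ] L2C :=
  LinearMap.mkContinuous
    { toFun := fun p => (tail_memLp m p).toLp (tailAverage m p)
      map_add' := by
        intro p q
        rw [← MemLp.toLp_add, MemLp.toLp_eq_toLp_iff]
        filter_upwards [ae_restrict_mem measurableSet_Ioo] with x hx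
        rw [Pi.add_apply, ← tail_add (Lp.memLp p) (Lp.memLp q) hx]
        exact tail_congr (Lp.coeFn_add p q) hx
      map_smul' := by
        intro c p
        rw [RingHom.id_apply, ← MemLp.toLp_const_smul, MemLp.toLp_eq_toLp_iff]
        filter_upwards [ae_restrict_mem measurableSet_Ioo] with x hx
        rw [Pi.smul_apply, smul_eq_mul, ← tail_smul]
        exact tail_congr (Lp.coeFn_smul c p) hx }
    2 (by
      intro p
      change ‖(tail_memLp m p).toLp (tailAverage m p)‖ ≤ _
      rw [Lp.norm_toLp (tailAverage m p) (tail_memLp m p), Lp.norm_def]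
      have := ENNReal.toReal_mono (ENNReal.mul_ne_top (by norm_num) (Lp.memLp p).2.ne)
        (tail_eLpNorm m p)
      simpa using this)

lemma tailOp_ae (m : ℕ) (p : L2C) : tailOp m p =ᵐ[μ01] tailAverage m p :=
  MemLp.coeFn_toLp (tail_memLp m p)

/-! ### The operators `S_a`, `T_a`, `B_a` -/

/-- First component of `S_a`: `S_0` is the identity, and
`S_{a+1}` sends `p` to `p(x) - 2(2a+1) x^{2a} ∫_x^1 p(t) / t^{2a+1} dt`. -/
def S₁ : ℕ → (L2C →L[ℂ] L2C)
  | 0 => ContinuousLinearMap.id ℂ L2C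
  | a + 1 => ContinuousLinearMap.id ℂ L2C - (2 * (2 * (a : ℂ) + 1)) • tailOp (2 * a)

/-- Second component of `S_a`: `S_0` is the identity, and
`S_{a+1}` sends `q` to `q(x) - 2(2a+1) x^{2a+1} ∫_x^1 q(t) / t^{2a+2} dt`. -/
def S₂ : ℕ → (L2C →L[ℂ] L2C)
  | 0 => ContinuousLinearMap.id ℂ L2C
  | a + 1 => ContinuousLinearMap.id ℂ L2C - (2 * (2 * (a : ℂ) + 1)) • tailOp (2 * a + 1)

lemma S₁_succ_ae (a : ℕ) (p : L2C) : ∀ᵐ x ∂μ01, S₁ (a + 1) p x =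
    p x - 2 * (2 * a + 1) * (x : ℂ) ^ (2 * a) * ∫ t in x..1, p t / (t : ℂ) ^ (2 * a + 1) := by
  have h : S₁ (a + 1) p = p - (2 * (2 * (a : ℂ) + 1)) • tailOp (2 * a) p := rfl
  rw [h]
  filter_upwards [Lp.coeFn_sub p ((2 * (2 * (a : ℂ) + 1)) • tailOp (2 * a) p),
    Lp.coeFn_smul (2 * (2 * (a : ℂ) + 1)) (tailOp (2 * a) p), tailOp_ae (2 * a) p]
    with x h1 h2 h3
  rw [h1, Pi.sub_apply, h2, Pi.smul_apply, h3, tailAverage, smul_eq_mul, mul_assoc _ (_ ^ _)]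

lemma S₂_succ_ae (a : ℕ) (q : L2C) : ∀ᵐ x ∂μ01, S₂ (a + 1) q x =
    q x - 2 * (2 * a + 1) * (x : ℂ) ^ (2 * a + 1) *
      ∫ t in x..1, q t / (t : ℂ) ^ (2 * a + 2) := by
  have h : S₂ (a + 1) q = q - (2 * (2 * (a : ℂ) + 1)) • tailOp (2 * a + 1) q := rfl
  rw [h]
  filter_upwards [Lp.coeFn_sub q ((2 * (2 * (a : ℂ) + 1)) • tailOp (2 * a + 1) q),
    Lp.coeFn_smul (2 * (2 * (a : ℂ) + 1)) (tailOp (2 * a + 1) q), tailOp_ae (2 * a + 1) q]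
    with x h1 h2 h3
  rw [h1, Pi.sub_apply, h2, Pi.smul_apply, h3, tailAverage, smul_eq_mul, mul_assoc _ (_ ^ _)]

/-- The operator `S_a[p, q] = (S₁ p, S₂ q)`. -/
def S (a : ℕ) : H →L[ℂ] H := diagOp (S₁ a) (S₂ a)

/-- The composition `A a ∘ ⋯ ∘ A 1` of a sequence of operators, read as `A 0` for `a = 0`. -/
def compDown {E : Type} [NormedAddCommGroup E] [NormedSpace ℂ E] (A : ℕ → (E →L[ℂ] E)) :
    ℕ → (E →L[ℂ] E)
  | 0 => A 0
  | 1 => A 1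
  | a + 2 => A (a + 2) ∘L compDown A (a + 1)

/-- `T_a = (-1)^{a+1} S_a ⋯ S_1` and `T_0 = -S_0`. -/
def T (a : ℕ) : H →L[ℂ] H := (-1 : ℂ) ^ (a + 1) • compDown S a

/-- First component of `T_a`. -/
def T₁ (a : ℕ) : L2C →L[ℂ] L2C := (-1 : ℂ) ^ (a + 1) • compDown S₁ a

/-- Second component of `T_a`. -/
def T₂ (a : ℕ) : L2C →L[ℂ] L2C := (-1 : ℂ) ^ (a + 1) • compDown S₂ a

/-- `B_a[f, g] = (T₂* f, T₁* g)`. -/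
def B (a : ℕ) : H →L[ℂ] H :=
  diagOp (ContinuousLinearMap.adjoint (T₂ a)) (ContinuousLinearMap.adjoint (T₁ a))

/-- `N_k`, the kernel of the adjoint of `S_k`. -/
def N (k : ℕ) : Submodule ℂ H := (ContinuousLinearMap.adjoint (S k)).ker

/-! ### Bessel functions -/

/-- The Bessel function of the first kind `J_ν(z)` (principal branch), for `z ≠ 0`. -/
def besselJ (ν z : ℂ) : ℂ :=
  ∑' m : ℕ, (-1 : ℂ) ^ m / ((m.factorial : ℂ) * Complex.Gamma (m + ν + 1)) *
    (z / 2) ^ (2 * (m : ℂ) + ν)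

/-- The spherical Bessel function `j_n(z) = √(πz/2) J_{n+1/2}(z)`, for `z ≠ 0`. -/
def sphJ (n : ℤ) (z : ℂ) : ℂ :=
  ((Real.pi : ℂ) * z / 2) ^ (1 / 2 : ℂ) * besselJ (n + 1 / 2) z

/-- The spherical Bessel function `η_n(z) = (-1)^n √(πz/2) J_{-n-1/2}(z)`, for `z ≠ 0`. -/
def sphEta (n : ℤ) (z : ℂ) : ℂ :=
  (-1 : ℂ) ^ n * ((Real.pi : ℂ) * z / 2) ^ (1 / 2 : ℂ) * besselJ (-n - 1 / 2) z

/-- Replace the value of `f` at `0` by its limit at `0`. -/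
def extendZero (f : ℂ → Fin 2 → ℂ) (z : ℂ) : Fin 2 → ℂ :=
  if z = 0 then limUnder (𝓝[≠] (0 : ℂ)) f else f z

/-- `Φ_a`, extended continuously to `z = 0`. -/
def Phi (a : ℕ) : ℂ → Fin 2 → ℂ := extendZero fun z =>
  ![-2 * sphJ ((a : ℤ) - 1) z * sphJ a z, sphJ a z ^ 2 - sphJ ((a : ℤ) - 1) z ^ 2]

/-- `Ψ_a`, extended continuously to `z = 0`. -/
def Psi (a : ℕ) : ℂ → Fin 2 → ℂ := extendZero fun z =>
  ![-sphEta ((a : ℤ) - 1) z * sphJ a z - sphEta a z * sphJ ((a : ℤ) - 1) z,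
    -sphEta ((a : ℤ) - 1) z * sphJ ((a : ℤ) - 1) z + sphEta a z * sphJ a z]

/-! ### Trigonometric vectors -/

lemma memLp_of_continuous {f : ℝ → ℂ} (hf : Continuous f) : MemLp f 2 μ01 := by
  obtain ⟨C, hC⟩ := isCompact_Icc.exists_bound_of_continuousOn (s := Icc (0:ℝ) 1) hf.continuousOn
  refine MemLp.of_bound hf.aestronglyMeasurable C ?_
  filter_upwards [ae_restrict_mem measurableSet_Ioo] with x hx
  exact hC x (Ioo_subset_Icc_self hx)

/-- The class in `L²(0,1)` of a continuous function. -/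
def ofCont (f : ℝ → ℂ) (hf : Continuous f) : L2C := (memLp_of_continuous hf).toLp f

/-- `x ↦ (sin 2λx, cos 2λx)` as an element of `L²(0,1) × L²(0,1)`. -/
def sinCos (l : ℂ) : H :=
  vec (ofCont (fun x => Complex.sin (2 * l * x)) (by fun_prop))
    (ofCont (fun x => Complex.cos (2 * l * x)) (by fun_prop))

/-- `x ↦ (cos 2λx, -sin 2λx)` as an element of `L²(0,1) × L²(0,1)`. -/
def cosNegSin (l : ℂ) : H :=
  vec (ofCont (fun x => Complex.cos (2 * l * x)) (by fun_prop))
    (ofCont (fun x => -Complex.sin (2 * l * x)) (by fun_prop))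

end

end AKNS

namespace AKNS

noncomputable section

/-! ### Monomials in `L²(0,1)` -/

/-! The adjoint of `tailOp m` is the average `f ↦ t^(-m-1) ∫_0^t x^m f(x) dx`, and every monomial is
an eigenvector: `x^k` has eigenvalue `1/(m+k+1)`. Monomials of degree at least `K` span a dense
subspace of `L²(0,1)`, for every `K`, so an identity between bounded operators built from the
`tailOp m` and their adjoints can be checked on them (`ext_mon`). This gives three facts: the
adjoints commute, they satisfy a resolvent identity, and `(m+n+1) • (tailOp n)* tailOp m = (tailOp
n)* + tailOp m`.

Inverse and range. The constant `2(2a+1)` in `S_{a+1}` is `m+n+1` for `m = 2a`, `n = 2a+1`, so the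
third fact says that `S₂*` is a left inverse of `S₁` (`adjoint_S₂_S₁`). The products telescope,
hence `B_a T_a = 1` (`B_T`). A bounded left inverse makes `T_a` injective with closed range, so its
range is `(ker T_a*)^⊥`.

Kernel. By the resolvent identity, `S_{b+1}*` acts on `N_{a+1}` as the scalar `(a-b)/(a+b+1)`, which
vanishes only for `b = a` (`adjoint_S_of_mem_N`), and the `N_k` lie in eigenspaces of one fixed
operator for the distinct eigenvalues `1/(2k)`. Induction on `a` then gives `ker_adjoint_T`.

Bessel functions. Both `j_n` and `η_n` obey the Riccati–Bessel recurrence and derivative formulas.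
These imply that, for either component `g_a` of `Φ_a` or `Ψ_a`, the derivative of `z^(m+1) (g_a +
g_{a+1})` is `2(2a+1) z^m g_a`, with `m = 2a` for the first component and `m = 2a+1` for the second.
Integrated from `0`, this says `S_{a+1}* g_a = -g_{a+1}`. Since `Φ_0` and `Ψ_0` are minus the
trigonometric vectors, `T_a*` maps the trigonometric vectors to `Φ_a` and `Ψ_a` (`adjoint_T_eq`).
The integral formulas are the same statement paired with an arbitrary element. -/

lemma integrable_continuous_mul {f : ℝ → ℂ} (hf : Continuous f) {g : ℝ → ℂ}
    (hg : Integrable g μ01) : Integrable (fun x => f x * g x) μ01 := by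
  obtain ⟨C, hC⟩ := isCompact_Icc.exists_bound_of_continuousOn (s := Icc (0:ℝ) 1) hf.continuousOn
  refine hg.bdd_mul (c := C) hf.aestronglyMeasurable ?_
  filter_upwards [ae_restrict_mem measurableSet_Ioo] with x hx
  exact hC x (Ioo_subset_Icc_self hx)

lemma integrable_coeFn (F : L2C) : Integrable F μ01 := (Lp.memLp F).integrable (by norm_num)

lemma ofCont_ae (f : ℝ → ℂ) (hf : Continuous f) : ofCont f hf =ᵐ[μ01] f :=
  MemLp.coeFn_toLp _

lemma ofCont_sub {f g : ℝ → ℂ} (hf : Continuous f) (hg : Continuous g) :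
    ofCont (fun x => f x - g x) (hf.sub hg) = ofCont f hf - ofCont g hg :=
  MemLp.toLp_sub _ _

lemma ofCont_smul (c : ℂ) {f : ℝ → ℂ} (hf : Continuous f) :
    ofCont (fun x => c * f x) (hf.const_mul c) = c • ofCont f hf :=
  MemLp.toLp_const_smul c (memLp_of_continuous hf)

lemma ofCont_congr {f g : ℝ → ℂ} {hf : Continuous f} {hg : Continuous g}
    (h : ∀ x ∈ Ioo (0:ℝ) 1, f x = g x) : ofCont f hf = ofCont g hg := by
  rw [ofCont, ofCont, MemLp.toLp_eq_toLp_iff]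
  filter_upwards [ae_restrict_mem measurableSet_Ioo] with x hx using h x hx

lemma inner_ofCont_left {f : ℝ → ℂ} (hf : Continuous f) (F : L2C) :
    inner ℂ (ofCont f hf) F = ∫ x, (starRingEnd ℂ) (f x) * F x ∂μ01 := by
  rw [L2.inner_def]
  refine integral_congr_ae ?_
  filter_upwards [ofCont_ae f hf] with x hx
  rw [hx, RCLike.inner_apply']

lemma integral_μ01 (f : ℝ → ℂ) : ∫ x, f x ∂μ01 = ∫ x in (0:ℝ)..1, f x := by
  rw [intervalIntegral.integral_of_le zero_le_one, integral_Ioc_eq_integral_Ioo]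

lemma inner_ofCont_ofCont {f g : ℝ → ℂ} (hf : Continuous f) (hg : Continuous g) :
    inner ℂ (ofCont f hf) (ofCont g hg) = ∫ x in (0:ℝ)..1, (starRingEnd ℂ) (f x) * g x := by
  rw [inner_ofCont_left, ← integral_μ01]
  refine integral_congr_ae ?_
  filter_upwards [ofCont_ae g hg] with x hx
  rw [hx]

/-- The monomial `x ^ k` as an element of `L²(0,1)`. -/
def mon (k : ℕ) : L2C := ofCont (fun x => (x : ℂ) ^ k) (by fun_prop)

lemma inner_mon_ofCont (k : ℕ) {g : ℝ → ℂ} (hg : Continuous g) :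
    inner ℂ (mon k) (ofCont g hg) = ∫ x in (0:ℝ)..1, (x : ℂ) ^ k * g x := by
  simp [mon, inner_ofCont_ofCont]

/-- The function `x^K F` is integrable and all its moments vanish. By Weierstrass approximation it
integrates to zero against every continuous function, so it is zero almost everywhere, and `x^K` can
be divided out on `(0,1)`. Leaving out low degrees matters because `tailOp m` has a convenient form
only on degrees above `m`. -/
lemma eq_zero_of_forall_inner_mon {K : ℕ} {F : L2C}
    (h : ∀ k, K ≤ k → inner ℂ (mon k) F = 0) : F = 0 := by
  have hmom : ∀ j : ℕ, ∫ x, (x : ℂ) ^ j * ((x : ℂ) ^ K * F x) ∂μ01 = 0 := by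
    intro j
    have := h (K + j) (by omega)
    rw [mon, inner_ofCont_left] at this
    rw [← this]
    refine integral_congr_ae (Eventually.of_forall fun x => ?_)
    simp only [map_pow, Complex.conj_ofReal]
    ring
  set g : ℝ → ℂ := fun x => (x : ℂ) ^ K * F x with hgdef
  have hg : Integrable g μ01 := integrable_continuous_mul (by fun_prop) (integrable_coeFn F)
  have hpoly : ∀ p : Polynomial ℝ, ∫ x, ((p.eval x : ℝ) : ℂ) * g x ∂μ01 = 0 := by
    intro p
    induction p using Polynomial.induction_on' with
    | add p q hp hq =>
      simp only [Polynomial.eval_add, Complex.ofReal_add, add_mul]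
      rw [integral_add (integrable_continuous_mul (by fun_prop) hg)
        (integrable_continuous_mul (by fun_prop) hg), hp, hq, add_zero]
    | monomial n c =>
      simp only [Polynomial.eval_monomial, Complex.ofReal_mul, Complex.ofReal_pow, mul_assoc]
      rw [integral_const_mul, hmom, mul_zero]
  have hzero : ∀ φ : ℝ → ℝ, Continuous φ → ∫ x, φ x • g x ∂μ01 = 0 := by
    intro φ hφ
    have hb : ∀ ε > 0, ‖∫ x, φ x • g x ∂μ01‖ ≤ ε * ∫ x, ‖g x‖ ∂μ01 := by
      intro ε hε
      obtain ⟨p, hp⟩ := exists_polynomial_near_of_continuousOn 0 1 φ hφ.continuousOn ε hε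
      have e : ∫ x, φ x • g x ∂μ01 = ∫ x, ((φ x - p.eval x : ℝ) : ℂ) * g x ∂μ01 := by
        simp only [Complex.ofReal_sub, sub_mul]
        rw [integral_sub (integrable_continuous_mul (by fun_prop) hg)
          (integrable_continuous_mul (by fun_prop) hg), hpoly, sub_zero]
        rfl
      rw [e, ← integral_const_mul]
      refine norm_integral_le_of_norm_le (hg.norm.const_mul ε) ?_
      filter_upwards [ae_restrict_mem measurableSet_Ioo] with x hx
      rw [norm_mul, Complex.norm_real, norm_sub_rev]
      gcongr
      exact (hp x (Ioo_subset_Icc_self hx)).le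
    rw [← norm_le_zero_iff]
    refine ge_of_tendsto (x := 𝓝[>] (0:ℝ)) (f := fun ε => ε * ∫ x, ‖g x‖ ∂μ01) ?_ ?_
    · have : Tendsto (fun ε : ℝ => ε * ∫ x, ‖g x‖ ∂μ01) (𝓝 0) (𝓝 (0 * ∫ x, ‖g x‖ ∂μ01)) :=
        (continuous_id.mul continuous_const).tendsto 0
      rw [zero_mul] at this
      exact this.mono_left nhdsWithin_le_nhds
    · filter_upwards [self_mem_nhdsWithin] with ε hε using hb ε hε
  have hae := ae_eq_zero_of_integral_contDiff_smul_eq_zero hg.locallyIntegrable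
    fun φ hφ _ => hzero φ hφ.continuous
  rw [Lp.eq_zero_iff_ae_eq_zero]
  filter_upwards [hae, ae_restrict_mem measurableSet_Ioo] with x hx hx0
  have : (x : ℂ) ≠ 0 := by exact_mod_cast hx0.1.ne'
  simpa [hgdef, this] using hx

lemma eq_of_forall_inner_mon {K : ℕ} {F G : L2C}
    (h : ∀ k, K ≤ k → inner ℂ (mon k) F = inner ℂ (mon k) G) : F = G := by
  refine sub_eq_zero.1 (eq_zero_of_forall_inner_mon (K := K) fun k hk => ?_)
  rw [inner_sub_right, h k hk, sub_self]

/-- Passing to adjoints turns agreement on monomials into equality of inner products with monomials,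
so density of the span need not be stated. -/
lemma ext_mon (K : ℕ) {A A' : L2C →L[ℂ] L2C} (h : ∀ k, K ≤ k → A (mon k) = A' (mon k)) :
    A = A' := by
  refine ContinuousLinearMap.adjoint.injective (ContinuousLinearMap.ext fun F => ?_)
  refine eq_of_forall_inner_mon (K := K) fun k hk => ?_
  rw [ContinuousLinearMap.adjoint_inner_right, ContinuousLinearMap.adjoint_inner_right, h k hk]

/-! ### The tail operators on monomials, and their adjoints -/

/-- For degree above `m` the integrand reduces to `t^j` with `j ≥ 0`; in degree exactly `m` a
logarithm would appear. -/
lemma tailOp_mon (m j : ℕ) :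
    tailOp m (mon (m + 1 + j)) = ((j : ℂ) + 1)⁻¹ • (mon m - mon (m + 1 + j)) := by
  have hj : (j : ℂ) + 1 ≠ 0 := Nat.cast_add_one_ne_zero j
  simp only [mon]
  rw [← ofCont_sub, ← ofCont_smul]
  refine Lp.ext ?_
  filter_upwards [tailOp_ae m (mon (m + 1 + j)), ofCont_ae (fun x : ℝ => ((j : ℂ) + 1)⁻¹ *
    ((x : ℂ) ^ m - (x : ℂ) ^ (m + 1 + j))) (by fun_prop), ae_restrict_mem measurableSet_Ioo]
    with x h1 h2 hx
  rw [mon] at h1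
  rw [h1, h2, tail_congr (ofCont_ae _ _) hx, tailAverage]
  have : ∫ t in x..1, (t : ℂ) ^ (m + 1 + j) / (t : ℂ) ^ (m + 1) =
      ∫ t in x..1, (t : ℂ) ^ j := by
    refine intervalIntegral.integral_congr fun t ht => ?_
    rw [uIcc_of_le hx.2.le] at ht
    have : (t : ℂ) ≠ 0 := by exact_mod_cast (hx.1.trans_le ht.1).ne'
    simp only [pow_add]
    field_simp
  rw [this]
  have h3 : ∫ t in x..1, (t : ℂ) ^ j = (1 - (x : ℂ) ^ (j + 1)) / (j + 1) := by
    have := @integral_pow x 1 j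
    simp only [← Complex.ofReal_pow]
    rw [intervalIntegral.integral_ofReal, this]
    push_cast
    simp
  rw [h3]
  field_simp
  ring

/-- With `G(t) = ∫_0^t x^m f`, pairing with `x^(m+1+j)` reduces the claim to integrating the
derivative of `t^(j+1) G(t)` over `[0,1]`; the boundary term at `0` vanishes. Testing on monomials
avoids exchanging the order of integration. -/
lemma adjoint_tailOp_ofCont {m : ℕ} {f g : ℝ → ℂ} (hf : Continuous f) (hg : Continuous g)
    (h : ∀ t ∈ Ioc (0:ℝ) 1, (t : ℂ) ^ (m + 1) * g t = ∫ x in (0:ℝ)..t, (x : ℂ) ^ m * f x) :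
    ContinuousLinearMap.adjoint (tailOp m) (ofCont f hf) = ofCont g hg := by
  refine eq_of_forall_inner_mon (K := m + 1) fun k hk => ?_
  obtain ⟨j, rfl⟩ := Nat.exists_eq_add_of_le hk
  have hj : (j : ℂ) + 1 ≠ 0 := Nat.cast_add_one_ne_zero j
  rw [ContinuousLinearMap.adjoint_inner_right, tailOp_mon, inner_smul_left, inner_sub_left,
    inner_mon_ofCont, inner_mon_ofCont, inner_mon_ofCont]
  set G : ℝ → ℂ := fun t => ∫ x in (0:ℝ)..t, (x : ℂ) ^ m * f x
  have hG : ∀ t : ℝ, HasDerivAt G ((t : ℂ) ^ m * f t) t := fun t =>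
    intervalIntegral.integral_hasDerivAt_right (Continuous.intervalIntegrable (by fun_prop) _ _)
      (Continuous.stronglyMeasurableAtFilter (by fun_prop) _ _) (by fun_prop)
  have hGc : Continuous G := continuous_iff_continuousAt.2 fun t => (hG t).continuousAt
  have hd : ∀ t : ℝ, HasDerivAt (fun t : ℝ => (t : ℂ) ^ (j + 1) * G t)
      (((j : ℂ) + 1) * (t : ℂ) ^ j * G t + (t : ℂ) ^ (j + 1) * ((t : ℂ) ^ m * f t)) t := by
    intro t
    have h1 : HasDerivAt (fun t : ℝ => (t : ℂ) ^ (j + 1)) (((j : ℂ) + 1) * (t : ℂ) ^ j) t := by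
      have := ((hasDerivAt_id (t : ℂ)).pow (j + 1)).comp_ofReal
      simpa using this
    exact h1.mul (hG t)
  have hI := intervalIntegral.integral_eq_sub_of_hasDerivAt (a := 0) (b := 1)
    (fun t _ => hd t) (Continuous.intervalIntegrable (by fun_prop) _ _)
  rw [intervalIntegral.integral_add (Continuous.intervalIntegrable (by fun_prop) _ _)
    (Continuous.intervalIntegrable (by fun_prop) _ _)] at hI
  have e1 : ∫ t in (0:ℝ)..1, ((j : ℂ) + 1) * (t : ℂ) ^ j * G t =
      ((j : ℂ) + 1) * ∫ t in (0:ℝ)..1, (t : ℂ) ^ (m + 1 + j) * g t := by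
    rw [← intervalIntegral.integral_const_mul]
    refine intervalIntegral.integral_congr_ae (Eventually.of_forall fun t ht => ?_)
    rw [uIoc_of_le zero_le_one] at ht
    have := h t ht
    simp only [G, ← this]
    ring
  have e2 : ∫ t in (0:ℝ)..1, (t : ℂ) ^ (j + 1) * ((t : ℂ) ^ m * f t) =
      ∫ t in (0:ℝ)..1, (t : ℂ) ^ (m + 1 + j) * f t := by
    refine intervalIntegral.integral_congr fun t _ => ?_
    ring
  rw [e1, e2] at hI
  have e3 : G 1 = ∫ x in (0:ℝ)..1, (x : ℂ) ^ m * f x := rfl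
  simp only [Complex.ofReal_one, one_pow, one_mul, Complex.ofReal_zero, zero_pow (Nat.succ_ne_zero j),
    zero_mul, sub_zero, e3] at hI
  rw [← hI, map_inv₀, map_add, Complex.conj_natCast, map_one]
  field_simp
  ring

lemma adjoint_tailOp_mon (m k : ℕ) :
    ContinuousLinearMap.adjoint (tailOp m) (mon k) = ((m : ℂ) + k + 1)⁻¹ • mon k := by
  have hj : (m : ℂ) + k + 1 ≠ 0 := by exact_mod_cast Nat.succ_ne_zero (m + k)
  rw [mon, ← ofCont_smul]
  refine adjoint_tailOp_ofCont _ _ fun t ht => ?_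
  have h3 : ∫ x in (0:ℝ)..t, (x : ℂ) ^ m * (x : ℂ) ^ k = (t : ℂ) ^ (m + k + 1) / (m + k + 1) := by
    have := @integral_pow 0 t (m + k)
    have e : ∀ x : ℝ, (x : ℂ) ^ m * (x : ℂ) ^ k = ((x ^ (m + k) : ℝ) : ℂ) := by
      intro x; push_cast; rw [pow_add]
    simp only [e]
    rw [intervalIntegral.integral_ofReal, this]
    push_cast
    simp
  rw [h3]
  field_simp
  ring

/-- A resolvent identity: on `x^k` the eigenvalues are the reciprocals of `m+k+1` and `n+k+1`, whose
difference does not depend on `k`. -/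
lemma adjoint_tailOp_comp_sub (m n : ℕ) :
    ContinuousLinearMap.adjoint (tailOp m) - ContinuousLinearMap.adjoint (tailOp n) =
      ((n : ℂ) - m) • (ContinuousLinearMap.adjoint (tailOp m) ∘L
        ContinuousLinearMap.adjoint (tailOp n)) := by
  refine ext_mon 0 fun k _ => ?_
  have h1 : (m : ℂ) + k + 1 ≠ 0 := by exact_mod_cast Nat.succ_ne_zero (m + k)
  have h2 : (n : ℂ) + k + 1 ≠ 0 := by exact_mod_cast Nat.succ_ne_zero (n + k)
  simp only [_root_.sub_apply, _root_.smul_apply,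
    ContinuousLinearMap.comp_apply, adjoint_tailOp_mon, map_smul, smul_smul, ← sub_smul]
  congr 1
  field_simp
  ring

lemma adjoint_tailOp_comm (m n : ℕ) :
    ContinuousLinearMap.adjoint (tailOp m) ∘L ContinuousLinearMap.adjoint (tailOp n) =
      ContinuousLinearMap.adjoint (tailOp n) ∘L ContinuousLinearMap.adjoint (tailOp m) := by
  refine ext_mon 0 fun k _ => ?_
  simp only [ContinuousLinearMap.comp_apply, adjoint_tailOp_mon, map_smul, smul_smul, mul_comm]

/-- This identity makes `1 - c (tailOp n)*` a left inverse of `1 - c tailOp m` when `c = m+n+1`: the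
quadratic term of the product cancels the linear ones. -/
lemma adjoint_tailOp_comp_tailOp (m n : ℕ) :
    ((m : ℂ) + n + 1) • (ContinuousLinearMap.adjoint (tailOp n) ∘L tailOp m) =
      ContinuousLinearMap.adjoint (tailOp n) + tailOp m := by
  refine ext_mon (m + 1) fun k hk => ?_
  obtain ⟨j, rfl⟩ := Nat.exists_eq_add_of_le hk
  have h1 : (n : ℂ) + m + 1 ≠ 0 := by exact_mod_cast Nat.succ_ne_zero (n + m)
  have h2 : (n : ℂ) + ((m + 1 + j : ℕ) : ℂ) + 1 ≠ 0 := by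
    exact_mod_cast Nat.succ_ne_zero (n + (m + 1 + j))
  have hj : (j : ℂ) + 1 ≠ 0 := Nat.cast_add_one_ne_zero j
  simp only [_root_.add_apply, _root_.smul_apply,
    ContinuousLinearMap.comp_apply, tailOp_mon, adjoint_tailOp_mon, map_smul, map_sub, smul_sub,
    smul_smul]
  match_scalars
  · field_simp
    ring
  · push_cast at h2 ⊢
    field_simp
    ring

open ContinuousLinearMap (adjoint)

/-! ### Diagonal operators and compositions -/

lemma adjoint_diagOp (A B : L2C →L[ℂ] L2C) :
    adjoint (diagOp A B) = diagOp (adjoint A) (adjoint B) := by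
  symm
  rw [ContinuousLinearMap.eq_adjoint_iff]
  rintro ⟨f, g⟩ ⟨f', g'⟩
  change inner ℂ (vec (adjoint A f) (adjoint B g)) (vec f' g') =
    inner ℂ (vec f g) (vec (A f') (B g'))
  simp only [WithLp.prod_inner_apply, ContinuousLinearMap.adjoint_inner_left]

lemma adjoint_S_vec (k : ℕ) (f g : L2C) :
    adjoint (S k) (vec f g) = vec (adjoint (S₁ k) f) (adjoint (S₂ k) g) := by
  rw [S, adjoint_diagOp, diagOp_vec]

section compDown

variable {E : Type} [NormedAddCommGroup E] [NormedSpace ℂ E] {A : ℕ → (E →L[ℂ] E)}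

lemma compDown_succ (h0 : A 0 = ContinuousLinearMap.id ℂ E) (a : ℕ) :
    compDown A (a + 1) = A (a + 1) ∘L compDown A a := by
  cases a with
  | zero => simp [compDown, h0]
  | succ a => rfl

lemma smul_compDown_zero (h0 : A 0 = ContinuousLinearMap.id ℂ E) :
    (-1 : ℂ) ^ (0 + 1) • compDown A 0 = -ContinuousLinearMap.id ℂ E := by
  simp [compDown, h0]

lemma smul_compDown_succ (h0 : A 0 = ContinuousLinearMap.id ℂ E) (a : ℕ) :
    (-1 : ℂ) ^ (a + 1 + 1) • compDown A (a + 1) =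
      -(A (a + 1) ∘L ((-1 : ℂ) ^ (a + 1) • compDown A a)) := by
  rw [compDown_succ h0, pow_succ, ContinuousLinearMap.comp_smul]
  simp

end compDown

lemma S_zero : S 0 = ContinuousLinearMap.id ℂ H := rfl

lemma T_zero : T 0 = -ContinuousLinearMap.id ℂ H := smul_compDown_zero S_zero

lemma T_succ (a : ℕ) : T (a + 1) = -(S (a + 1) ∘L T a) := smul_compDown_succ S_zero a

lemma T₁_zero : T₁ 0 = -ContinuousLinearMap.id ℂ L2C := smul_compDown_zero rfl

lemma T₁_succ (a : ℕ) : T₁ (a + 1) = -(S₁ (a + 1) ∘L T₁ a) := smul_compDown_succ rfl a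

lemma T₂_zero : T₂ 0 = -ContinuousLinearMap.id ℂ L2C := smul_compDown_zero rfl

lemma T₂_succ (a : ℕ) : T₂ (a + 1) = -(S₂ (a + 1) ∘L T₂ a) := smul_compDown_succ rfl a

lemma T_vec (a : ℕ) (f g : L2C) : T a (vec f g) = vec (T₁ a f) (T₂ a g) := by
  induction a with
  | zero => rw [T_zero, T₁_zero, T₂_zero]; rfl
  | succ a ih =>
    rw [T_succ, T₁_succ, T₂_succ, neg_apply, ContinuousLinearMap.comp_apply, ih]
    rfl

lemma T_eq_diagOp (a : ℕ) : T a = diagOp (T₁ a) (T₂ a) :=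
  ContinuousLinearMap.ext fun F => T_vec a F.fst F.snd

lemma adjoint_T_vec (a : ℕ) (f g : L2C) :
    adjoint (T a) (vec f g) = vec (adjoint (T₁ a) f) (adjoint (T₂ a) g) := by
  rw [T_eq_diagOp, adjoint_diagOp, diagOp_vec]

lemma adjoint_T_zero : adjoint (T 0) = -ContinuousLinearMap.id ℂ H := by
  rw [T_zero, map_neg, ContinuousLinearMap.adjoint_id]

lemma adjoint_T_succ (a : ℕ) (F : H) :
    adjoint (T (a + 1)) F = -adjoint (T a) (adjoint (S (a + 1)) F) := by
  rw [T_succ, map_neg, ContinuousLinearMap.adjoint_comp]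
  rfl

/-! ### The adjoints of `S₁` and `S₂` -/

lemma adjoint_id_sub_smul_tailOp (a m : ℕ) :
    adjoint (ContinuousLinearMap.id ℂ L2C - (2 * (2 * (a : ℂ) + 1)) • tailOp m) =
      ContinuousLinearMap.id ℂ L2C - (2 * (2 * (a : ℂ) + 1)) • adjoint (tailOp m) := by
  rw [map_sub, ContinuousLinearMap.adjoint_id, map_smulₛₗ]
  have h2 : (starRingEnd ℂ) 2 = 2 := Complex.conj_natCast 2
  simp [h2]

lemma adjoint_S₁_succ (a : ℕ) (f : L2C) :
    adjoint (S₁ (a + 1)) f = f - (2 * (2 * (a : ℂ) + 1)) • adjoint (tailOp (2 * a)) f := by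
  rw [S₁, adjoint_id_sub_smul_tailOp]
  rfl

lemma adjoint_S₂_succ (a : ℕ) (f : L2C) :
    adjoint (S₂ (a + 1)) f = f - (2 * (2 * (a : ℂ) + 1)) • adjoint (tailOp (2 * a + 1)) f := by
  rw [S₂, adjoint_id_sub_smul_tailOp]
  rfl

lemma adjoint_S₂_S₁ (k : ℕ) (f : L2C) : adjoint (S₂ k) (S₁ k f) = f := by
  cases k with
  | zero => rw [S₁, S₂, ContinuousLinearMap.adjoint_id]; rfl
  | succ a =>
    have h := congrArg (fun A => A f) (adjoint_tailOp_comp_tailOp (2 * a) (2 * a + 1))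
    simp only [_root_.add_apply, _root_.smul_apply, ContinuousLinearMap.comp_apply] at h
    have e : S₁ (a + 1) f = f - (2 * (2 * (a : ℂ) + 1)) • tailOp (2 * a) f := rfl
    rw [adjoint_S₂_succ, e, map_sub, map_smul]
    -- The coefficient in `S_{a+1}` is exactly the `m+n+1` of the product identity, with `m` and `n`
    -- taken from the two different components.
    have hc : ((2 * a : ℕ) : ℂ) + ((2 * a + 1 : ℕ) : ℂ) + 1 = 2 * (2 * (a : ℂ) + 1) := by
      push_cast; ring
    rw [hc] at h
    rw [h]
    module

/-- Taking adjoints reverses the order of the factors, so the innermost pair is `S₂* S₁` of the same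
index and the product telescopes; the signs cancel in pairs. -/
lemma adjoint_T₂_T₁ (a : ℕ) (f : L2C) : adjoint (T₂ a) (T₁ a f) = f := by
  induction a generalizing f with
  | zero => rw [T₁_zero, T₂_zero, map_neg, ContinuousLinearMap.adjoint_id]; simp
  | succ a ih =>
    rw [T₁_succ, T₂_succ, map_neg, ContinuousLinearMap.adjoint_comp]
    simp [adjoint_S₂_S₁, ih]

lemma adjoint_T₁_T₂ (a : ℕ) (f : L2C) : adjoint (T₁ a) (T₂ a f) = f := by
  refine ext_inner_left ℂ fun v => ?_
  rw [ContinuousLinearMap.adjoint_inner_right, ← ContinuousLinearMap.adjoint_inner_left,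
    adjoint_T₂_T₁]

lemma B_T (a : ℕ) (F : H) : B a (T a F) = F := by
  obtain ⟨f, g⟩ := F
  rw [T_vec, B, diagOp_vec, adjoint_T₂_T₁, adjoint_T₁_T₂]

lemma T_injective (a : ℕ) : Function.Injective (T a) := Function.LeftInverse.injective (B_T a)

/-! ### Commutation -/

lemma adjoint_S_comm (a b : ℕ) (F : H) :
    adjoint (S a) (adjoint (S b) F) = adjoint (S b) (adjoint (S a) F) := by
  obtain ⟨f, g⟩ := F
  have h : ∀ m n (f : L2C), adjoint (tailOp m) (adjoint (tailOp n) f) =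
      adjoint (tailOp n) (adjoint (tailOp m) f) := fun m n f =>
    congrArg (fun A => A f) (adjoint_tailOp_comm m n)
  rcases a with _ | a
  · rw [S_zero, ContinuousLinearMap.adjoint_id]; rfl
  rcases b with _ | b
  · rw [S_zero, ContinuousLinearMap.adjoint_id]; rfl
  simp only [adjoint_S_vec, adjoint_S₁_succ, adjoint_S₂_succ, map_sub, map_smul]
  rw [h (2 * a), h (2 * a + 1)]
  refine congrArg₂ vec ?_ ?_ <;> module

lemma adjoint_T_adjoint_S (a b : ℕ) (F : H) :
    adjoint (T a) (adjoint (S b) F) = adjoint (S b) (adjoint (T a) F) := by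
  induction a generalizing F with
  | zero => rw [adjoint_T_zero]; simp
  | succ a ih => rw [adjoint_T_succ, adjoint_T_succ, adjoint_S_comm, ih, map_neg]

/-- The adjoint of the recursion puts `S_{a+1}*` first; commutation lets it act last, as needed to
pass from the image under `T_a*` to the image under `T_{a+1}*`. -/
lemma adjoint_T_succ' (a : ℕ) (F : H) :
    adjoint (T (a + 1)) F = -adjoint (S (a + 1)) (adjoint (T a) F) := by
  rw [adjoint_T_succ, adjoint_T_adjoint_S]

/-! ### The kernels `N_k` -/

/-- By the resolvent identity an eigenvector of one averaging operator is an eigenvector of all of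
them, and the reciprocal eigenvalue moves by the change of index: `2(2a+1) + (2b - 2a) = 2(a+b+1)`.
The offset `i` is `0` for the first component and `1` for the second. -/
lemma adjoint_tailOp_of_eq {a i : ℕ} (b : ℕ) {f : L2C}
    (h : f - (2 * (2 * (a : ℂ) + 1)) • adjoint (tailOp (2 * a + i)) f = 0) :
    adjoint (tailOp (2 * b + i)) f = (2 * ((a : ℂ) + b + 1))⁻¹ • f := by
  have hr := congrArg (fun A => A f) (adjoint_tailOp_comp_sub (2 * b + i) (2 * a + i))
  simp only [_root_.sub_apply, _root_.smul_apply, ContinuousLinearMap.comp_apply] at hr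
  have hc : (2 * (a : ℂ) + 1) ≠ 0 := by exact_mod_cast Nat.succ_ne_zero (2 * a)
  have hd : ((a : ℂ) + b + 1) ≠ 0 := by exact_mod_cast Nat.succ_ne_zero (a + b)
  have hc' : 2 * (2 * (a : ℂ) + 1) ≠ 0 := mul_ne_zero two_ne_zero hc
  have e : adjoint (tailOp (2 * a + i)) f = (2 * (2 * (a : ℂ) + 1))⁻¹ • f := by
    rw [eq_inv_smul_iff₀ hc']
    exact (sub_eq_zero.1 h).symm
  rw [e, map_smul, smul_smul, sub_eq_iff_eq_add] at hr
  rw [eq_inv_smul_iff₀ (mul_ne_zero two_ne_zero hd)]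
  have : (1 - (((2 * a + i : ℕ) : ℂ) - ((2 * b + i : ℕ) : ℂ)) * (2 * (2 * (a : ℂ) + 1))⁻¹) •
      adjoint (tailOp (2 * b + i)) f = (2 * (2 * (a : ℂ) + 1))⁻¹ • f := by
    rw [sub_smul, one_smul, sub_eq_iff_eq_add]
    exact hr.trans (add_comm _ _)
  rw [eq_inv_smul_iff₀ hc', smul_smul] at this
  refine Eq.trans ?_ this
  congr 1
  push_cast
  field_simp
  ring

lemma adjoint_S_of_mem_N {a : ℕ} (b : ℕ) {F : H} (hF : F ∈ N (a + 1)) :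
    adjoint (S (b + 1)) F = (((a : ℂ) - b) / (a + b + 1)) • F := by
  obtain ⟨f, g⟩ := F
  have hd : ((a : ℂ) + b + 1) ≠ 0 := by exact_mod_cast Nat.succ_ne_zero (a + b)
  have h0 : vec (adjoint (S₁ (a + 1)) f) (adjoint (S₂ (a + 1)) g) = vec 0 0 := by
    rw [← adjoint_S_vec]; exact hF
  obtain ⟨h1, h2⟩ := Prod.ext_iff.1 (WithLp.toLp_injective 2 h0)
  rw [adjoint_S₁_succ] at h1
  rw [adjoint_S₂_succ] at h2
  rw [adjoint_S_vec, adjoint_S₁_succ, adjoint_S₂_succ, adjoint_tailOp_of_eq b h2,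
    show 2 * b = 2 * b + 0 from rfl, adjoint_tailOp_of_eq (i := 0) b h1]
  have (f : L2C) : f - (2 * (2 * (b : ℂ) + 1)) • (2 * ((a : ℂ) + b + 1))⁻¹ • f =
      (((a : ℂ) - b) / (a + b + 1)) • f := by
    match_scalars
    field_simp
    ring
  rw [this, this]
  rfl

lemma diagOp_of_mem_N {a : ℕ} {F : H} (hF : F ∈ N (a + 1)) :
    diagOp (adjoint (tailOp 0)) (adjoint (tailOp 1)) F = (2 * ((a + 1 : ℕ) : ℂ))⁻¹ • F := by
  obtain ⟨f, g⟩ := F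
  have h0 : vec (adjoint (S₁ (a + 1)) f) (adjoint (S₂ (a + 1)) g) = vec 0 0 := by
    rw [← adjoint_S_vec]; exact hF
  obtain ⟨h1, h2⟩ := Prod.ext_iff.1 (WithLp.toLp_injective 2 h0)
  rw [adjoint_S₁_succ] at h1
  rw [adjoint_S₂_succ] at h2
  have e1 := adjoint_tailOp_of_eq (i := 0) 0 h1
  have e2 := adjoint_tailOp_of_eq (i := 1) 0 h2
  simp only [Nat.cast_zero, add_zero, mul_zero, zero_add] at e1 e2
  rw [diagOp_vec, e1, e2]
  push_cast
  rfl

/-- Each `N_k` lies in the eigenspace for `1/(2k)` of one operator that does not depend on `k`, and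
eigenspaces for distinct eigenvalues are independent. -/
lemma iSupIndep_N (a : ℕ) : iSupIndep (fun k : Finset.Icc 1 a => N k) := by
  have h := Module.End.eigenspaces_iSupIndep
    (diagOp (adjoint (tailOp 0)) (adjoint (tailOp 1)) : H →L[ℂ] H).toLinearMap
  refine (h.comp (f := fun k : Finset.Icc 1 a => (2 * ((k : ℕ) : ℂ))⁻¹) ?_).mono ?_
  · intro k l hkl
    have : ((k : ℕ) : ℂ) = (l : ℕ) := by simpa using hkl
    exact Subtype.ext (Nat.cast_injective this)
  · rintro ⟨k, hk⟩ F hF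
    obtain ⟨b, rfl⟩ := Nat.exists_eq_add_of_le' (Finset.mem_Icc.1 hk).1
    exact Module.End.mem_eigenspace_iff.2 (diagOp_of_mem_N hF)

lemma ker_adjoint_T (a : ℕ) : (adjoint (T a)).ker = ⨆ k : Finset.Icc 1 a, N k := by
  induction a with
  | zero =>
    have : IsEmpty (Finset.Icc 1 0) := Finset.isEmpty_coe_sort.2 rfl
    rw [iSup_of_empty, adjoint_T_zero, eq_bot_iff]
    intro F hF
    simpa using hF
  | succ a ih =>
    have hle : (⨆ k : Finset.Icc 1 a, N k) ≤ ⨆ k : Finset.Icc 1 (a + 1), N k := by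
      refine iSup_le fun k => ?_
      have hk := Finset.mem_Icc.1 k.2
      exact le_iSup (fun k : Finset.Icc 1 (a + 1) => N k)
        ⟨k, Finset.mem_Icc.2 ⟨hk.1, hk.2.trans a.le_succ⟩⟩
    apply le_antisymm
    · intro F hF
      have h1 : adjoint (S (a + 1)) F ∈ (adjoint (T a)).ker := by
        have : adjoint (T (a + 1)) F = 0 := hF
        rw [adjoint_T_succ, neg_eq_zero] at this
        exact this
      -- `S_{a+1}*` acts on each earlier `N_k` by a nonzero scalar, so it maps the sum of these
      -- spaces onto itself. Hence `S_{a+1}* F` has a preimage `G` in the sum, and `F - G` lies in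
      -- `N_{a+1}`.
      have h2 : (⨆ k : Finset.Icc 1 a, N k) ≤
          (⨆ k : Finset.Icc 1 a, N k).map (adjoint (S (a + 1))).toLinearMap := by
        refine iSup_le fun k G hG => ?_
        have hk := Finset.mem_Icc.1 k.2
        obtain ⟨b, hb⟩ := Nat.exists_eq_add_of_le' hk.1
        have hS := adjoint_S_of_mem_N (a := b) a (hb ▸ hG)
        have hne : ((b : ℂ) - a) / (b + a + 1) ≠ 0 := by
          refine div_ne_zero (sub_ne_zero.2 ?_) (by exact_mod_cast Nat.succ_ne_zero (b + a))
          exact_mod_cast (by omega : b ≠ a)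
        refine ⟨(((b : ℂ) - a) / (b + a + 1))⁻¹ • G,
          Submodule.smul_mem _ _ ((le_iSup (fun k : Finset.Icc 1 a => N k) k) hG), ?_⟩
        change adjoint (S (a + 1)) _ = _
        rw [map_smul, hS, inv_smul_smul₀ hne]
      rw [ih] at h1
      obtain ⟨G, hG, hGF⟩ := h2 h1
      have h3 : F - G ∈ N (a + 1) := by
        change adjoint (S (a + 1)) (F - G) = 0
        rw [map_sub, sub_eq_zero]
        exact hGF.symm
      rw [← sub_add_cancel F G]
      refine add_mem ?_ (hle hG)
      exact (le_iSup (fun k : Finset.Icc 1 (a + 1) => N k)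
        ⟨a + 1, Finset.mem_Icc.2 ⟨by omega, le_rfl⟩⟩) h3
    · refine iSup_le fun k F hF => ?_
      have hk := Finset.mem_Icc.1 k.2
      change adjoint (T (a + 1)) F = 0
      rcases hk.2.lt_or_eq with h | h
      · have : F ∈ (adjoint (T a)).ker := by
          rw [ih]
          exact (le_iSup (fun k : Finset.Icc 1 a => N k)
            ⟨k, Finset.mem_Icc.2 ⟨hk.1, Nat.lt_succ_iff.1 h⟩⟩) hF
        have hz : adjoint (T a) F = 0 := this
        rw [adjoint_T_succ', hz, map_zero, neg_zero]
      · have hz : adjoint (S (a + 1)) F = 0 := h ▸ hF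
        rw [adjoint_T_succ, hz, map_zero, neg_zero]

/-! ### The range of `T_a` -/

lemma range_T (a : ℕ) : (T a).range = (⨆ k : Finset.Icc 1 a, N k)ᗮ := by
  have hclosed : IsClosed ((T a).range : Set H) := by
    -- A bounded left inverse exhibits the range as the fixed-point set of the continuous map `T_a
    -- B_a`, hence closed.
    have : ((T a).range : Set H) = {G | T a (B a G) = G} := by
      ext G
      constructor
      · rintro ⟨F, rfl⟩
        exact congrArg (T a) (B_T a F)
      · intro h
        exact ⟨B a G, h⟩
    rw [this]
    exact isClosed_eq (by fun_prop) continuous_id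
  rw [← ker_adjoint_T, ← ContinuousLinearMap.orthogonal_range,
    Submodule.orthogonal_orthogonal_eq_closure, hclosed.submodule_topologicalClosure_eq]

lemma exists_equiv (a : ℕ) : ∃ e : H ≃L[ℂ] ↥(⨆ k : Finset.Icc 1 a, N k)ᗮ,
    (∀ F : H, (e F : H) = T a F) ∧
      ∀ G : ↥(⨆ k : Finset.Icc 1 a, N k)ᗮ, e.symm G = B a G := by
  have hmem : ∀ F, T a F ∈ (⨆ k : Finset.Icc 1 a, N k)ᗮ := fun F => by
    rw [← range_T]; exact ⟨F, rfl⟩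
  refine ⟨ContinuousLinearEquiv.equivOfInverse ((T a).codRestrict _ hmem)
    (B a ∘L Submodule.subtypeL _) (fun F => B_T a F) ?_, fun F => rfl, fun G => rfl⟩
  rintro ⟨G, hG⟩
  rw [← range_T] at hG
  obtain ⟨F, rfl⟩ := hG
  exact Subtype.ext (congrArg (T a) (B_T a F))

/-! ### Power series of the spherical Bessel functions -/

/-- Coefficients of the entire function `w ↦ ∑ (-w)^m / (m! Γ(m + n + 3/2))`. -/
def besselCoeff (n : ℤ) (m : ℕ) : ℂ :=
  (-1 : ℂ) ^ m / ((m.factorial : ℂ) * Complex.Gamma (m + (n + 1 / 2) + 1))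

/-- The entire function with `j_n(z) = √π (z/2)^(n+1) besselEntire n ((z/2)^2)`. -/
def besselEntire (n : ℤ) (w : ℂ) : ℂ := ∑' m : ℕ, besselCoeff n m * w ^ m

lemma int_add_half_ne_zero (k : ℤ) : (k : ℂ) + 1 / 2 ≠ 0 := by
  intro h
  have h1 : (2 * k + 1 : ℂ) = 0 := by linear_combination 2 * h
  have h2 : 2 * k + 1 = 0 := by exact_mod_cast h1
  omega

lemma Gamma_add_half_ne_zero (n : ℤ) (m : ℕ) : Complex.Gamma (m + (n + 1 / 2) + 1) ≠ 0 := by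
  refine Complex.Gamma_ne_zero fun k hk => ?_
  refine int_add_half_ne_zero (m + n + 1 + k) ?_
  push_cast
  linear_combination hk

lemma besselCoeff_pred (n : ℤ) (m : ℕ) :
    besselCoeff (n - 1) m = (m + n + 1 / 2) * besselCoeff n m := by
  have h0 : (m : ℂ) + n + 1 / 2 ≠ 0 := by exact_mod_cast int_add_half_ne_zero (m + n)
  have h1 := Complex.Gamma_add_one _ h0
  have hG := Gamma_add_half_ne_zero n m
  have e1 : (m : ℂ) + (((n - 1 : ℤ) : ℂ) + 1 / 2) + 1 = m + n + 1 / 2 := by push_cast; ring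
  have e2 : (m : ℂ) + ((n : ℂ) + 1 / 2) + 1 = m + n + 1 / 2 + 1 := by ring
  rw [e2, h1] at hG
  have hm : (m.factorial : ℂ) ≠ 0 := by exact_mod_cast m.factorial_ne_zero
  rw [besselCoeff, besselCoeff, e1, e2, h1, mul_div_assoc', mul_left_comm,
    mul_div_mul_left _ _ h0]

lemma besselCoeff_succ (n : ℤ) (m : ℕ) :
    ((m : ℂ) + 1) * besselCoeff n (m + 1) = -besselCoeff (n + 1) m := by
  have hG := Gamma_add_half_ne_zero (n + 1) m
  have hm : (m.factorial : ℂ) ≠ 0 := by exact_mod_cast m.factorial_ne_zero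
  have hm1 : (m : ℂ) + 1 ≠ 0 := Nat.cast_add_one_ne_zero m
  have e : ((m + 1 : ℕ) : ℂ) + ((n : ℂ) + 1 / 2) + 1 =
      m + (((n + 1 : ℤ) : ℂ) + 1 / 2) + 1 := by push_cast; ring
  rw [besselCoeff, besselCoeff, e, Nat.factorial_succ, pow_succ]
  push_cast at hG ⊢
  field_simp

lemma besselCoeff_ratio (n : ℤ) (m : ℕ) :
    ((m : ℂ) + 1) * (m + n + 3 / 2) * besselCoeff n (m + 1) = -besselCoeff n m := by
  have h1 := besselCoeff_succ n m
  have h2 := besselCoeff_pred (n + 1) m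
  rw [add_sub_cancel_right] at h2
  push_cast at h2
  linear_combination (m + n + 3 / 2 : ℂ) * h1 + h2

lemma summable_norm_besselCoeff (n : ℤ) {r : ℝ} (hr : 0 ≤ r) :
    Summable fun m => ‖besselCoeff n m‖ * r ^ m := by
  refine summable_of_ratio_norm_eventually_le (r := 1 / 2) (by norm_num) ?_
  -- For the ratio test: `m ≥ |n|` makes `m + n` nonnegative, and `m ≥ 2r` then makes
  -- `(m+1)(m+n+3/2)` at least `2r`, so the ratio is at most `1/2`.
  obtain ⟨M, hM⟩ := exists_nat_ge (2 * r)
  filter_upwards [eventually_ge_atTop (max M n.natAbs)] with m hm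
  have hm1 : M ≤ m := (le_max_left _ _).trans hm
  have hm2 : n.natAbs ≤ m := (le_max_right _ _).trans hm
  have h1 := congrArg norm (besselCoeff_ratio n m)
  have e : ((m : ℂ) + 1) * (m + n + 3 / 2) = (((m + 1 : ℝ) * (m + n + 3 / 2) : ℝ) : ℂ) := by
    push_cast; ring
  have h2 : (0 : ℝ) ≤ m + n := by exact_mod_cast (by omega : (0 : ℤ) ≤ m + n)
  rw [norm_neg, norm_mul, e, Complex.norm_real, Real.norm_of_nonneg (by positivity)] at h1
  have h3 : 2 * r ≤ (m + 1 : ℝ) * (m + n + 3 / 2) := by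
    have : (M : ℝ) ≤ m := by exact_mod_cast hm1
    nlinarith
  rw [Real.norm_of_nonneg (by positivity), Real.norm_of_nonneg (by positivity), ← h1, pow_succ]
  have := mul_le_mul_of_nonneg_right h3
    (mul_nonneg (norm_nonneg (besselCoeff n (m + 1))) (pow_nonneg hr m))
  linarith

lemma summable_besselCoeff (n : ℤ) (w : ℂ) : Summable fun m => besselCoeff n m * w ^ m := by
  refine Summable.of_norm ?_
  simpa only [norm_mul, norm_pow] using summable_norm_besselCoeff n (norm_nonneg w)

lemma continuous_besselEntire (n : ℤ) : Continuous (besselEntire n) := by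
  refine continuous_iff_continuousAt.2 fun w => ?_
  refine ContinuousOn.continuousAt (s := Metric.ball 0 (‖w‖ + 1)) ?_
    (Metric.isOpen_ball.mem_nhds (by simp))
  refine continuousOn_tsum (fun m => by fun_prop)
    (summable_norm_besselCoeff n (r := ‖w‖ + 1) (by positivity)) fun m z hz => ?_
  rw [norm_mul, norm_pow]
  gcongr
  exact (mem_ball_zero_iff.1 hz).le

/-- The factor `m + n + 1/2` from the functional equation of Gamma is split: `n + 1/2` reproduces
the series, while `m` cancels against the factorial and shifts it to order `n + 1`. -/
lemma besselEntire_pred (n : ℤ) (w : ℂ) :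
    besselEntire (n - 1) w = (n + 1 / 2) * besselEntire n w - w * besselEntire (n + 1) w := by
  have h1 : HasSum (fun m : ℕ => (m : ℂ) * (besselCoeff n m * w ^ m))
      (-(w * besselEntire (n + 1) w)) := by
    rw [← hasSum_nat_add_iff' 1]
    simp only [Finset.range_one, Finset.sum_singleton, Nat.cast_zero, zero_mul, sub_zero]
    have e : (fun m : ℕ => ((m + 1 : ℕ) : ℂ) * (besselCoeff n (m + 1) * w ^ (m + 1))) =
        fun m => -(w * (besselCoeff (n + 1) m * w ^ m)) := by
      funext m
      push_cast
      rw [← mul_assoc, besselCoeff_succ, pow_succ]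
      ring
    rw [e]
    exact ((summable_besselCoeff (n + 1) w).hasSum.mul_left w).neg
  have h2 : HasSum _ (-(w * besselEntire (n + 1) w) + (n + 1 / 2) * besselEntire n w) :=
    h1.add ((summable_besselCoeff n w).hasSum.mul_left ((n : ℂ) + 1 / 2))
  have h3 : HasSum (fun m : ℕ => besselCoeff (n - 1) m * w ^ m)
      (-(w * besselEntire (n + 1) w) + (n + 1 / 2) * besselEntire n w) := by
    convert h2 using 2 with m
    rw [besselCoeff_pred]
    ring
  rw [besselEntire, h3.tsum_eq]
  ring

lemma besselEntire_conj (n : ℤ) (w : ℂ) :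
    besselEntire n ((starRingEnd ℂ) w) = (starRingEnd ℂ) (besselEntire n w) := by
  rw [besselEntire, besselEntire, Complex.conj_tsum]
  refine tsum_congr fun m => ?_
  have : (m : ℂ) + (n + 1 / 2) + 1 = ((m + (n + 1 / 2) + 1 : ℝ) : ℂ) := by push_cast; rfl
  rw [besselCoeff, this, Complex.Gamma_ofReal]
  simp

/-! ### The functions `j_n` and `η_n` -/

/-- Since `π > 0`, the square root splits on the principal branch, and the two half-integer powers
of `z/2` combine into an integer power. No branch cut remains, for negative `n` as well. -/
lemma sphJ_eq (n : ℤ) {z : ℂ} (hz : z ≠ 0) :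
    sphJ n z = (Real.pi : ℂ) ^ (1 / 2 : ℂ) * ((z / 2) ^ (n + 1) * besselEntire n ((z / 2) ^ 2)) := by
  have hz2 : z / 2 ≠ 0 := div_ne_zero hz two_ne_zero
  have hpi : (Real.pi : ℂ) ≠ 0 := by exact_mod_cast Real.pi_ne_zero
  have h1 : ((Real.pi : ℂ) * z / 2) ^ (1 / 2 : ℂ) =
      (Real.pi : ℂ) ^ (1 / 2 : ℂ) * (z / 2) ^ (1 / 2 : ℂ) := by
    rw [mul_div_assoc, Complex.cpow_def_of_ne_zero (mul_ne_zero hpi hz2),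
      Complex.cpow_def_of_ne_zero hpi, Complex.cpow_def_of_ne_zero hz2,
      Complex.log_ofReal_mul Real.pi_pos hz2, add_mul, Complex.exp_add, Complex.ofReal_log
      Real.pi_pos.le]
  rw [sphJ, h1, mul_assoc]
  congr 1
  rw [besselJ, besselEntire, ← tsum_mul_left, ← tsum_mul_left]
  refine tsum_congr fun m => ?_
  have h2 : (z / 2) ^ (1 / 2 : ℂ) * (z / 2) ^ (2 * (m : ℂ) + (n + 1 / 2)) =
      (z / 2) ^ (n + 1) * ((z / 2) ^ 2) ^ m := by
    rw [← Complex.cpow_add _ _ hz2, ← pow_mul, ← zpow_natCast, ← zpow_add₀ hz2,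
      ← Complex.cpow_intCast]
    congr 1
    push_cast
    ring
  rw [besselCoeff, mul_left_comm, h2]
  ring

lemma sphEta_eq (n : ℤ) (z : ℂ) : sphEta n z = (-1 : ℂ) ^ n * sphJ (-n - 1) z := by
  have : -(n : ℂ) - 1 / 2 = ((-n - 1 : ℤ) : ℂ) + 1 / 2 := by push_cast; ring
  rw [sphEta, sphJ, this, mul_assoc]

lemma pi_cpow_half_mul_self :
    (Real.pi : ℂ) ^ (1 / 2 : ℂ) * (Real.pi : ℂ) ^ (1 / 2 : ℂ) = Real.pi := by
  rw [← Complex.cpow_add _ _ (by exact_mod_cast Real.pi_ne_zero)]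
  norm_num

lemma sphJ_mul_sphJ {n k : ℤ} {p : ℕ} (h : n + k + 2 = p) {z : ℂ} (hz : z ≠ 0) :
    sphJ n z * sphJ k z = Real.pi * (z / 2) ^ p *
      (besselEntire n ((z / 2) ^ 2) * besselEntire k ((z / 2) ^ 2)) := by
  have hz2 : z / 2 ≠ 0 := div_ne_zero hz two_ne_zero
  have : (z / 2) ^ p = (z / 2) ^ (n + 1) * (z / 2) ^ (k + 1) := by
    rw [← zpow_natCast, ← h, ← zpow_add₀ hz2]
    congr 1
    ring
  rw [sphJ_eq n hz, sphJ_eq k hz, this]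
  linear_combination (z / 2) ^ (n + 1) * (z / 2) ^ (k + 1) * (besselEntire n ((z / 2) ^ 2) *
    besselEntire k ((z / 2) ^ 2)) * pi_cpow_half_mul_self

lemma sphJ_succ (n : ℤ) {z : ℂ} (hz : z ≠ 0) :
    sphJ (n + 1) z = (2 * n + 1) / z * sphJ n z - sphJ (n - 1) z := by
  have hz2 : z / 2 ≠ 0 := div_ne_zero hz two_ne_zero
  rw [sphJ_eq _ hz, sphJ_eq _ hz, sphJ_eq _ hz, besselEntire_pred, sub_add_cancel,
    zpow_add_one₀ hz2, zpow_add_one₀ hz2]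
  field_simp
  ring

lemma sphJ_conj (n : ℤ) {z : ℂ} (hz : z ≠ 0) :
    sphJ n ((starRingEnd ℂ) z) = (starRingEnd ℂ) (sphJ n z) := by
  have hpi : (Real.pi : ℂ) ^ (1 / 2 : ℂ) = ((Real.pi ^ (1 / 2 : ℝ) : ℝ) : ℂ) := by
    rw [Complex.ofReal_cpow Real.pi_pos.le]
    norm_num
  have h2 : (starRingEnd ℂ) 2 = 2 := Complex.conj_natCast 2
  rw [sphJ_eq n hz, sphJ_eq n (by simpa using hz), hpi]
  simp only [map_mul, map_zpow₀, map_div₀, h2, ← besselEntire_conj, map_pow, Complex.conj_ofReal]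

lemma sphEta_conj (n : ℤ) {z : ℂ} (hz : z ≠ 0) :
    sphEta n ((starRingEnd ℂ) z) = (starRingEnd ℂ) (sphEta n z) := by
  rw [sphEta_eq, sphEta_eq, sphJ_conj _ hz]
  simp

/-- The value of Gamma at half-integers, `(2m)! √π = 4^m m! Γ(m + 1/2)`, obtained by induction from
the coefficient ratio; it identifies `j_{-1}` with the cosine. -/
lemma besselCoeff_neg_one (m : ℕ) : (Real.pi : ℂ) ^ (1 / 2 : ℂ) * besselCoeff (-1) m =
    (-1) ^ m * 4 ^ m / ((2 * m).factorial : ℂ) := by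
  induction m with
  | zero =>
    have h := Gamma_add_half_ne_zero (-1) 0
    have e : ((0 : ℕ) : ℂ) + (((-1 : ℤ) : ℂ) + 1 / 2) + 1 = 1 / 2 := by push_cast; ring
    rw [e, Complex.Gamma_one_half_eq] at h
    rw [besselCoeff, e, Complex.Gamma_one_half_eq]
    simp only [Nat.factorial_zero, pow_zero, mul_zero, Nat.cast_one, one_mul]
    field_simp
  | succ m ih =>
    have hr := besselCoeff_ratio (-1) m
    have h1 : (m : ℂ) + 1 ≠ 0 := Nat.cast_add_one_ne_zero m
    have h2 : 2 * (m : ℂ) + 1 ≠ 0 := by exact_mod_cast Nat.succ_ne_zero (2 * m)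
    have hf : ((2 * m).factorial : ℂ) ≠ 0 := by exact_mod_cast (2 * m).factorial_ne_zero
    rw [eq_div_iff hf] at ih
    rw [show 2 * (m + 1) = 2 * m + 1 + 1 by ring, Nat.factorial_succ, Nat.factorial_succ]
    push_cast at hr ⊢
    rw [eq_div_iff (mul_ne_zero (by convert mul_ne_zero two_ne_zero h1 using 1; ring)
      (mul_ne_zero h2 hf)), pow_succ, pow_succ]
    linear_combination 4 * (Real.pi : ℂ) ^ (1 / 2 : ℂ) * ((2 * m).factorial : ℂ) * hr - 4 * ih

lemma besselCoeff_zero (m : ℕ) : (Real.pi : ℂ) ^ (1 / 2 : ℂ) * besselCoeff 0 m =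
    2 * ((-1) ^ m * 4 ^ m / ((2 * m + 1).factorial : ℂ)) := by
  have h := besselCoeff_pred 0 m
  have h2 : 2 * (m : ℂ) + 1 ≠ 0 := by exact_mod_cast Nat.succ_ne_zero (2 * m)
  have hf : ((2 * m).factorial : ℂ) ≠ 0 := by exact_mod_cast (2 * m).factorial_ne_zero
  have h1 := besselCoeff_neg_one m
  rw [zero_sub] at h
  rw [h, eq_div_iff hf] at h1
  rw [Nat.factorial_succ, mul_div_assoc', eq_div_iff (by push_cast; exact mul_ne_zero h2 hf)]
  push_cast at h1 ⊢
  linear_combination 2 * h1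

lemma sphJ_neg_one {z : ℂ} (hz : z ≠ 0) : sphJ (-1) z = Complex.cos z := by
  rw [sphJ_eq _ hz, neg_add_cancel, zpow_zero, one_mul, besselEntire, ← tsum_mul_left,
    ← (Complex.hasSum_cos z).tsum_eq]
  refine tsum_congr fun m => ?_
  rw [← mul_assoc, besselCoeff_neg_one, div_pow, div_pow, pow_mul,
    show ((2 : ℂ) ^ 2) ^ m = 4 ^ m by norm_num]
  have : (4 : ℂ) ^ m ≠ 0 := pow_ne_zero _ (by norm_num)
  field_simp

lemma sphJ_zero {z : ℂ} (hz : z ≠ 0) : sphJ 0 z = Complex.sin z := by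
  rw [sphJ_eq _ hz, zero_add, zpow_one, besselEntire, ← tsum_mul_left, ← tsum_mul_left,
    ← (Complex.hasSum_sin z).tsum_eq]
  refine tsum_congr fun m => ?_
  rw [mul_left_comm, ← mul_assoc _ (besselCoeff 0 m), besselCoeff_zero,
    show (z / 2) ^ 2 = z ^ 2 / 4 by ring, div_pow, pow_succ z (2 * m), pow_mul z]
  have : (4 : ℂ) ^ m ≠ 0 := pow_ne_zero _ (by norm_num)
  field_simp

/-! ### Riccati–Bessel sequences -/

/-- A sequence `X k = y_{k-1}` of solutions of the Riccati–Bessel recurrence on `z ≠ 0`. -/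
structure IsRiccatiBessel (X : ℕ → ℂ → ℂ) : Prop where
  recurrence : ∀ (n : ℕ) (z : ℂ), z ≠ 0 →
    X (n + 2) z = (2 * n + 1) / z * X (n + 1) z - X n z
  hasDerivAt_zero : ∀ z : ℂ, z ≠ 0 → HasDerivAt (X 0) (-X 1 z) z
  hasDerivAt_one : ∀ z : ℂ, z ≠ 0 → HasDerivAt (X 1) (X 0 z) z

lemma isRiccatiBessel_sphJ : IsRiccatiBessel fun k => sphJ ((k : ℤ) - 1) where
  recurrence n z hz := by
    have := sphJ_succ (n : ℤ) hz
    convert this using 3 <;> push_cast <;> ring_nf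
  hasDerivAt_zero z hz := by
    simp only [Nat.cast_zero, zero_sub, Nat.cast_one, sub_self]
    rw [sphJ_zero hz]
    refine (Complex.hasDerivAt_cos z).congr_of_eventuallyEq ?_
    filter_upwards [isOpen_ne.mem_nhds hz] with w hw using sphJ_neg_one hw
  hasDerivAt_one z hz := by
    simp only [Nat.cast_zero, zero_sub, Nat.cast_one, sub_self]
    rw [sphJ_neg_one hz]
    refine (Complex.hasDerivAt_sin z).congr_of_eventuallyEq ?_
    filter_upwards [isOpen_ne.mem_nhds hz] with w hw using sphJ_zero hw

lemma sphEta_neg_one {z : ℂ} (hz : z ≠ 0) : sphEta (-1) z = -Complex.sin z := by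
  rw [sphEta_eq]
  norm_num [sphJ_zero hz]

lemma sphEta_zero {z : ℂ} (hz : z ≠ 0) : sphEta 0 z = Complex.cos z := by
  rw [sphEta_eq]
  norm_num [sphJ_neg_one hz]

/-- Because `η_n = (-1)^n j_{-n-1}`, the recurrence is that of `j` run downwards, with the
alternating sign restoring its form. -/
lemma isRiccatiBessel_sphEta : IsRiccatiBessel fun k => sphEta ((k : ℤ) - 1) where
  recurrence n z hz := by
    have h := sphJ_succ (-(n : ℤ) - 1) hz
    have hm : (-1 : ℂ) ≠ 0 := by norm_num
    simp only [sphEta_eq]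
    have e1 : -(((n + 2 : ℕ) : ℤ) - 1) - 1 = -(n : ℤ) - 1 - 1 := by push_cast; ring
    have e2 : -(((n + 1 : ℕ) : ℤ) - 1) - 1 = -(n : ℤ) - 1 := by push_cast; ring
    have e3 : -((n : ℤ) - 1) - 1 = -(n : ℤ) - 1 + 1 := by ring
    have e4 : ((n + 2 : ℕ) : ℤ) - 1 = (n : ℤ) - 1 + 1 + 1 := by push_cast; ring
    have e5 : ((n + 1 : ℕ) : ℤ) - 1 = (n : ℤ) - 1 + 1 := by push_cast; ring
    rw [e1, e2, e3, e4, e5, h, zpow_add_one₀ hm, zpow_add_one₀ hm]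
    push_cast
    ring
  hasDerivAt_zero z hz := by
    simp only [Nat.cast_zero, zero_sub, Nat.cast_one, sub_self]
    rw [sphEta_zero hz]
    refine (Complex.hasDerivAt_sin z).neg.congr_of_eventuallyEq ?_
    filter_upwards [isOpen_ne.mem_nhds hz] with w hw using sphEta_neg_one hw
  hasDerivAt_one z hz := by
    simp only [Nat.cast_zero, zero_sub, Nat.cast_one, sub_self]
    rw [sphEta_neg_one hz]
    refine (Complex.hasDerivAt_cos z).congr_of_eventuallyEq ?_
    filter_upwards [isOpen_ne.mem_nhds hz] with w hw using sphEta_zero hw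

namespace IsRiccatiBessel

variable {X Y : ℕ → ℂ → ℂ}

/-- The two formulas are proved together: the recurrence rewrites the second as the first of the
next index, and differentiating the recurrence gives the next second one. -/
lemma hasDerivAt (hX : IsRiccatiBessel X) (n : ℕ) {z : ℂ} (hz : z ≠ 0) :
    HasDerivAt (X n) (n / z * X n z - X (n + 1) z) z ∧
      HasDerivAt (X (n + 1)) (X n z - n / z * X (n + 1) z) z := by
  induction n with
  | zero => exact ⟨by simpa using hX.hasDerivAt_zero z hz, by simpa using hX.hasDerivAt_one z hz⟩
  | succ n ih =>
    obtain ⟨h1, h2⟩ := ih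
    constructor
    · convert h2 using 1
      rw [hX.recurrence n z hz]
      push_cast
      field_simp
      ring
    · have hd : HasDerivAt (fun w : ℂ => (2 * n + 1) / w)
          (-(2 * (n : ℂ) + 1) / z ^ 2) z := by
        have := (hasDerivAt_const z (2 * (n : ℂ) + 1)).fun_div (hasDerivAt_id' z) hz
        simpa using this
      have h3 := (hd.mul h2).sub h1
      have h4 : X (n + 2) =ᶠ[𝓝 z] fun w => (2 * n + 1) / w * X (n + 1) w - X n w := by
        filter_upwards [isOpen_ne.mem_nhds hz] with w hw using hX.recurrence n w hw
      refine (h3.congr_of_eventuallyEq h4).congr_deriv ?_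
      rw [hX.recurrence n z hz]
      push_cast
      field_simp
      ring

/-- The off-diagonal product `-(x_{a-1} y_a + x_a y_{a-1})`. -/
def cross (X Y : ℕ → ℂ → ℂ) (a : ℕ) (z : ℂ) : ℂ := -X a z * Y (a + 1) z - X (a + 1) z * Y a z

/-- The diagonal product `x_a y_a - x_{a-1} y_{a-1}`. -/
def diag (X Y : ℕ → ℂ → ℂ) (a : ℕ) (z : ℂ) : ℂ := X (a + 1) z * Y (a + 1) z - X a z * Y a z

/-- Writing `x_a = X (a+1)` and `y_a = Y (a+1)`, the recurrence collapses the sum to `-2(2a+1) x_a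
y_a / z`, and the derivative of `z^(2a) x_a y_a` is `z^(2a) (x_{a-1} y_a + x_a y_{a-1})`. -/
lemma hasDerivAt_cross (hX : IsRiccatiBessel X) (hY : IsRiccatiBessel Y) (a : ℕ) {z : ℂ}
    (hz : z ≠ 0) :
    HasDerivAt (fun w => w ^ (2 * a + 1) * (cross X Y a w + cross X Y (a + 1) w))
      (2 * (2 * (a : ℂ) + 1) * (z ^ (2 * a) * cross X Y a z)) z := by
  obtain ⟨-, hx⟩ := hX.hasDerivAt a hz
  obtain ⟨-, hy⟩ := hY.hasDerivAt a hz
  have h := (((hasDerivAt_id z).pow (2 * a)).mul (hx.mul hy)).const_mul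
    (-2 * (2 * (a : ℂ) + 1))
  have he : (fun w => w ^ (2 * a + 1) * (cross X Y a w + cross X Y (a + 1) w)) =ᶠ[𝓝 z]
      fun w => -2 * (2 * (a : ℂ) + 1) * (w ^ (2 * a) * (X (a + 1) w * Y (a + 1) w)) := by
    filter_upwards [isOpen_ne.mem_nhds hz] with w hw
    have hw' : w ≠ 0 := hw
    simp only [cross, hX.recurrence a w hw, hY.recurrence a w hw]
    field_simp
    ring
  refine (h.congr_of_eventuallyEq he).congr_deriv ?_
  rw [cross]
  -- The derivative of `z^(2a)` carries the truncated exponent `2a - 1`, so `a = 0` is separate.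
  rcases a with _ | a
  · simp
    ring
  · rw [show 2 * (a + 1) - 1 = 2 * a + 1 by omega, show 2 * (a + 1) = 2 * a + 1 + 1 by ring]
    simp
    field_simp
    ring

lemma hasDerivAt_diag (hX : IsRiccatiBessel X) (hY : IsRiccatiBessel Y) (a : ℕ) {z : ℂ}
    (hz : z ≠ 0) :
    HasDerivAt (fun w => w ^ (2 * a + 1 + 1) * (diag X Y a w + diag X Y (a + 1) w))
      (2 * (2 * (a : ℂ) + 1) * (z ^ (2 * a + 1) * diag X Y a z)) z := by
  obtain ⟨hx0, hx⟩ := hX.hasDerivAt a hz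
  obtain ⟨hy0, hy⟩ := hY.hasDerivAt a hz
  have h := ((((hasDerivAt_id z).pow (2 * a)).mul (hx.mul hy)).const_mul
    ((2 * (a : ℂ) + 1) ^ 2)).sub ((((hasDerivAt_id z).pow (2 * a + 1)).mul
      ((hx0.mul hy).add (hx.mul hy0))).const_mul (2 * (a : ℂ) + 1))
  have he : (fun w => w ^ (2 * a + 1 + 1) * (diag X Y a w + diag X Y (a + 1) w)) =ᶠ[𝓝 z]
      fun w => (2 * (a : ℂ) + 1) ^ 2 * (w ^ (2 * a) * (X (a + 1) w * Y (a + 1) w)) -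
        (2 * (a : ℂ) + 1) * (w ^ (2 * a + 1) *
          (X a w * Y (a + 1) w + X (a + 1) w * Y a w)) := by
    filter_upwards [isOpen_ne.mem_nhds hz] with w hw
    have hw' : w ≠ 0 := hw
    simp only [diag, hX.recurrence a w hw, hY.recurrence a w hw]
    field_simp
    ring
  refine (h.congr_of_eventuallyEq he).congr_deriv ?_
  rw [diag]
  rcases a with _ | a
  · simp
    ring
  · rw [show 2 * (a + 1) - 1 = 2 * a + 1 by omega, show 2 * (a + 1) + 1 - 1 = 2 * a + 1 + 1 by omega,
      show 2 * (a + 1) = 2 * a + 1 + 1 by ring]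
    simp
    field_simp
    ring

end IsRiccatiBessel

/-! ### The vectors `Φ_a` and `Ψ_a` -/

lemma extendZero_of_ne (f : ℂ → Fin 2 → ℂ) {z : ℂ} (hz : z ≠ 0) : extendZero f z = f z :=
  if_neg hz

/-- A continuous formula agreeing with `f` off `0` determines the limit at `0`, so the extension is
that formula. -/
lemma continuous_extendZero {f g : ℂ → Fin 2 → ℂ} (hg : Continuous g)
    (h : ∀ z, z ≠ 0 → f z = g z) : Continuous (extendZero f) := by
  have hlim : limUnder (𝓝[≠] (0 : ℂ)) f = g 0 := by
    refine Tendsto.limUnder_eq ((hg.tendsto 0).mono_left nhdsWithin_le_nhds |>.congr' ?_)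
    filter_upwards [self_mem_nhdsWithin] with z hz using (h z hz).symm
  have : extendZero f = g := by
    funext z
    by_cases hz : z = 0
    · rw [extendZero, if_pos hz, hlim, hz]
    · rw [extendZero_of_ne f hz, h z hz]
  rwa [this]

lemma continuous_Phi (a : ℕ) : Continuous (Phi a) := by
  have hE := continuous_besselEntire
  refine continuous_extendZero (g := fun z =>
    ![-2 * (Real.pi * (z / 2) ^ (2 * a + 1) *
        (besselEntire ((a : ℤ) - 1) ((z / 2) ^ 2) * besselEntire a ((z / 2) ^ 2))),
      Real.pi * (z / 2) ^ (2 * a + 2) *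
        (besselEntire a ((z / 2) ^ 2) * besselEntire a ((z / 2) ^ 2)) -
      Real.pi * (z / 2) ^ (2 * a) *
        (besselEntire ((a : ℤ) - 1) ((z / 2) ^ 2) * besselEntire ((a : ℤ) - 1) ((z / 2) ^ 2))])
    ?_ fun z hz => ?_
  · refine continuous_pi fun i => ?_
    fin_cases i
    · exact (by fun_prop : Continuous fun z : ℂ => -2 * (Real.pi * (z / 2) ^ (2 * a + 1) *
        (besselEntire ((a : ℤ) - 1) ((z / 2) ^ 2) * besselEntire a ((z / 2) ^ 2))))
    · exact (by fun_prop : Continuous fun z : ℂ => Real.pi * (z / 2) ^ (2 * a + 2) *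
        (besselEntire a ((z / 2) ^ 2) * besselEntire a ((z / 2) ^ 2)) -
        Real.pi * (z / 2) ^ (2 * a) *
        (besselEntire ((a : ℤ) - 1) ((z / 2) ^ 2) * besselEntire ((a : ℤ) - 1) ((z / 2) ^ 2)))
  · rw [mul_assoc, pow_two (sphJ _ _), pow_two (sphJ _ _),
      sphJ_mul_sphJ (p := 2 * a + 1) (by push_cast; ring) hz,
      sphJ_mul_sphJ (p := 2 * a + 2) (by push_cast; ring) hz,
      sphJ_mul_sphJ (p := 2 * a) (by push_cast; ring) hz]

/-- Although `η_n` may be singular at `0`, the powers of `z/2` in the four products add up to `2`,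
`0`, `1` and `1`, so each product is entire. -/
lemma continuous_Psi (a : ℕ) : Continuous (Psi a) := by
  have hE := continuous_besselEntire
  refine continuous_extendZero (g := fun z =>
    ![-((-1) ^ ((a : ℤ) - 1) * (Real.pi * (z / 2) ^ 2 *
        (besselEntire (-((a : ℤ) - 1) - 1) ((z / 2) ^ 2) * besselEntire a ((z / 2) ^ 2)))) -
      (-1) ^ (a : ℤ) * (Real.pi * (z / 2) ^ 0 *
        (besselEntire (-(a : ℤ) - 1) ((z / 2) ^ 2) * besselEntire ((a : ℤ) - 1) ((z / 2) ^ 2))),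
      -((-1) ^ ((a : ℤ) - 1) * (Real.pi * (z / 2) ^ 1 *
        (besselEntire (-((a : ℤ) - 1) - 1) ((z / 2) ^ 2) *
          besselEntire ((a : ℤ) - 1) ((z / 2) ^ 2)))) +
      (-1) ^ (a : ℤ) * (Real.pi * (z / 2) ^ 1 *
        (besselEntire (-(a : ℤ) - 1) ((z / 2) ^ 2) * besselEntire a ((z / 2) ^ 2)))])
    ?_ fun z hz => ?_
  · refine continuous_pi fun i => ?_
    fin_cases i <;> dsimp <;> fun_prop
  · rw [neg_mul, neg_mul]
    simp only [sphEta_eq]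
    rw [mul_assoc, mul_assoc, mul_assoc, mul_assoc,
      sphJ_mul_sphJ (p := 2) (by push_cast; ring) hz,
      sphJ_mul_sphJ (p := 0) (by push_cast; ring) hz,
      sphJ_mul_sphJ (p := 1) (by push_cast; ring) hz,
      sphJ_mul_sphJ (p := 1) (by push_cast; ring) hz]

lemma Phi_of_ne (a : ℕ) {z : ℂ} (hz : z ≠ 0) :
    Phi a z = ![IsRiccatiBessel.cross (fun k => sphJ ((k : ℤ) - 1)) (fun k => sphJ ((k : ℤ) - 1)) a z,
      IsRiccatiBessel.diag (fun k => sphJ ((k : ℤ) - 1)) (fun k => sphJ ((k : ℤ) - 1)) a z] := by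
  rw [Phi, extendZero_of_ne _ hz]
  simp only [IsRiccatiBessel.cross, IsRiccatiBessel.diag, Nat.cast_add, Nat.cast_one,
    add_sub_cancel_right]
  congr 1
  · ring
  · congr 1
    ring

lemma Psi_of_ne (a : ℕ) {z : ℂ} (hz : z ≠ 0) :
    Psi a z = ![IsRiccatiBessel.cross (fun k => sphEta ((k : ℤ) - 1))
        (fun k => sphJ ((k : ℤ) - 1)) a z,
      IsRiccatiBessel.diag (fun k => sphEta ((k : ℤ) - 1)) (fun k => sphJ ((k : ℤ) - 1)) a z] := by
  rw [Psi, extendZero_of_ne _ hz]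
  simp only [IsRiccatiBessel.cross, IsRiccatiBessel.diag, Nat.cast_add, Nat.cast_one,
    add_sub_cancel_right]
  congr 1
  congr 1
  ring

lemma Phi_zero (z : ℂ) : Phi 0 z = ![-Complex.sin (2 * z), -Complex.cos (2 * z)] := by
  refine congrFun (Continuous.ext_on (dense_compl_singleton (0 : ℂ)) (continuous_Phi 0)
    (g := fun z => ![-Complex.sin (2 * z), -Complex.cos (2 * z)])
    (continuous_pi fun i => by fin_cases i <;> dsimp <;> fun_prop) fun w hw => ?_) z
  have hw : w ≠ 0 := hw
  rw [Phi, extendZero_of_ne _ hw]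
  simp only [Nat.cast_zero, zero_sub, sphJ_zero hw, sphJ_neg_one hw, Complex.sin_two_mul,
    Complex.cos_two_mul']
  congr 1
  · ring
  · congr 1
    ring

lemma Psi_zero (z : ℂ) : Psi 0 z = ![-Complex.cos (2 * z), Complex.sin (2 * z)] := by
  refine congrFun (Continuous.ext_on (dense_compl_singleton (0 : ℂ)) (continuous_Psi 0)
    (g := fun z => ![-Complex.cos (2 * z), Complex.sin (2 * z)])
    (continuous_pi fun i => by fin_cases i <;> dsimp <;> fun_prop) fun w hw => ?_) z
  have hw : w ≠ 0 := hw
  rw [Psi, extendZero_of_ne _ hw]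
  simp only [Nat.cast_zero, zero_sub, sphJ_zero hw, sphJ_neg_one hw, sphEta_zero hw,
    sphEta_neg_one hw, Complex.sin_two_mul, Complex.cos_two_mul']
  congr 1
  · ring
  · congr 1
    ring

lemma Phi_conj (a : ℕ) (z : ℂ) :
    Phi a ((starRingEnd ℂ) z) = fun i => (starRingEnd ℂ) (Phi a z i) := by
  have hP := continuous_Phi a
  refine congrFun (Continuous.ext_on (dense_compl_singleton (0 : ℂ))
    (hP.comp Complex.continuous_conj) (g := fun z i => (starRingEnd ℂ) (Phi a z i))
    (continuous_pi fun i => Complex.continuous_conj.comp ((continuous_apply i).comp hP))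
    fun w hw => ?_) z
  have hw : w ≠ 0 := hw
  have h2 : (starRingEnd ℂ) 2 = 2 := Complex.conj_natCast 2
  funext i
  have hw' : (starRingEnd ℂ) w ≠ 0 := by simpa using hw
  simp only [Function.comp_apply, Phi, extendZero_of_ne _ hw, extendZero_of_ne _ hw']
  fin_cases i <;> simp [sphJ_conj _ hw, h2]

lemma Psi_conj (a : ℕ) (z : ℂ) :
    Psi a ((starRingEnd ℂ) z) = fun i => (starRingEnd ℂ) (Psi a z i) := by
  have hP := continuous_Psi a
  refine congrFun (Continuous.ext_on (dense_compl_singleton (0 : ℂ))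
    (hP.comp Complex.continuous_conj) (g := fun z i => (starRingEnd ℂ) (Psi a z i))
    (continuous_pi fun i => Complex.continuous_conj.comp ((continuous_apply i).comp hP))
    fun w hw => ?_) z
  have hw : w ≠ 0 := hw
  funext i
  have hw' : (starRingEnd ℂ) w ≠ 0 := by simpa using hw
  simp only [Function.comp_apply, Psi, extendZero_of_ne _ hw, extendZero_of_ne _ hw']
  fin_cases i <;> simp [sphJ_conj _ hw, sphEta_conj _ hw]

/-! ### The action of `T_a^*` on trigonometric vectors -/

/-- For `l ≠ 0` this is the fundamental theorem of calculus along `x ↦ l x`, with the power of `l`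
scaled out and no boundary term at `0`. Both sides are continuous in `l`, which covers `l = 0`. -/
lemma pow_mul_eq_integral {G g : ℂ → ℂ} (hG : Continuous G) (hg : Continuous g) {m : ℕ} {c : ℂ}
    (h : ∀ z, z ≠ 0 → HasDerivAt (fun w => w ^ (m + 1) * G w) (c * (z ^ m * g z)) z)
    (l : ℂ) {t : ℝ} (ht : 0 ≤ t) :
    (t : ℂ) ^ (m + 1) * G (l * t) = c * ∫ x in (0:ℝ)..t, (x : ℂ) ^ m * g (l * x) := by
  refine congrFun (Continuous.ext_on (dense_compl_singleton (0 : ℂ))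
    (f := fun l => (t : ℂ) ^ (m + 1) * G (l * t))
    (g := fun l => c * ∫ x in (0:ℝ)..t, (x : ℂ) ^ m * g (l * x)) (by fun_prop) ?_
    fun l hl => ?_) l
  · exact continuous_const.mul
      (intervalIntegral.continuous_parametric_intervalIntegral_of_continuous' (by fun_prop) _ _)
  have hl : l ≠ 0 := hl
  have hd : ∀ x ∈ Ioo 0 t, HasDerivAt (fun x : ℝ => (x : ℂ) ^ (m + 1) * G (l * x))
      (c * ((x : ℂ) ^ m * g (l * x))) x := by
    intro x hx
    have hx0 : (x : ℂ) ≠ 0 := by exact_mod_cast hx.1.ne'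
    have h1 : HasDerivAt (fun w : ℂ => l * w) l x := by
      simpa using (hasDerivAt_id (x : ℂ)).const_mul l
    have h2 := (((h (l * x) (mul_ne_zero hl hx0)).comp (x : ℂ) h1).const_mul
      (l ^ (m + 1))⁻¹).comp_ofReal
    have h3 : (fun x : ℝ => (x : ℂ) ^ (m + 1) * G (l * x)) =
        fun x : ℝ => (l ^ (m + 1))⁻¹ * ((fun w => w ^ (m + 1) * G w) ∘ fun w => l * w) x := by
      funext x
      simp only [Function.comp_apply]
      field_simp
      ring
    rw [h3]
    refine h2.congr_deriv ?_
    field_simp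
    ring
  have := intervalIntegral.integral_eq_sub_of_hasDerivAt_of_le ht
    (Continuous.continuousOn (by fun_prop)) hd (Continuous.intervalIntegrable (by fun_prop) _ _)
  rw [intervalIntegral.integral_const_mul] at this
  simp [this]

lemma id_sub_smul_adjoint_tailOp_ofCont {G g : ℂ → ℂ} (hG : Continuous G) (hg : Continuous g)
    {m a : ℕ} (h : ∀ z, z ≠ 0 → HasDerivAt (fun w => w ^ (m + 1) * (g w + G w))
      (2 * (2 * (a : ℂ) + 1) * (z ^ m * g z)) z) (l : ℂ) :
    ofCont (fun x => g (l * x)) (by fun_prop) - (2 * (2 * (a : ℂ) + 1)) •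
      adjoint (tailOp m) (ofCont (fun x => g (l * x)) (by fun_prop)) =
        -ofCont (fun x => G (l * x)) (by fun_prop) := by
  have hc : (2 * (2 * (a : ℂ) + 1)) ≠ 0 := by exact_mod_cast (by omega : 2 * (2 * a + 1) ≠ 0)
  rw [adjoint_tailOp_ofCont (g := fun x : ℝ => (2 * (2 * (a : ℂ) + 1))⁻¹ *
    (g (l * x) + G (l * x))) _ (by fun_prop) fun t ht => ?_]
  · rw [← ofCont_smul, ← ofCont_sub, ← neg_one_smul ℂ, ← ofCont_smul]
    refine ofCont_congr fun x _ => ?_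
    rw [mul_inv_cancel_left₀ hc]
    ring
  · rw [mul_left_comm, pow_mul_eq_integral (G := fun z => g z + G z) (by fun_prop) hg h l ht.1.le,
      inv_mul_cancel_left₀ hc]

/-- One induction serves both families: `X = Y = j` gives `Φ`, and `X = η`, `Y = j` gives `Ψ`. The
minus sign in `F` matches `T_0 = -1`. -/
lemma adjoint_T_eq {X Y : ℕ → ℂ → ℂ} (hX : IsRiccatiBessel X) (hY : IsRiccatiBessel Y)
    {P : ℕ → ℂ → Fin 2 → ℂ} (hP : ∀ a, Continuous (P a))
    (hP0 : ∀ a z, z ≠ 0 → P a z = ![IsRiccatiBessel.cross X Y a z, IsRiccatiBessel.diag X Y a z])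
    (l : ℂ) {F : H} (hF : F = vec (ofCont (fun x => -P 0 (l * x) 0) (by fun_prop))
      (ofCont (fun x => -P 0 (l * x) 1) (by fun_prop))) (a : ℕ) :
    adjoint (T a) F = vec (ofCont (fun x => P a (l * x) 0) (by fun_prop))
      (ofCont (fun x => P a (l * x) 1) (by fun_prop)) := by
  have hneg : ∀ {f : ℝ → ℂ} (hf : Continuous f),
      ofCont (fun x => -f x) hf.neg = -ofCont f hf := fun hf => MemLp.toLp_neg _
  induction a with
  | zero =>
    rw [adjoint_T_zero, hF, hneg (f := fun x => P 0 (l * x) 0) (by fun_prop),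
      hneg (f := fun x => P 0 (l * x) 1) (by fun_prop)]
    exact congrArg₂ vec (neg_neg _) (neg_neg _)
  | succ a ih =>
    have h1 := id_sub_smul_adjoint_tailOp_ofCont (G := fun z => P (a + 1) z 0)
      (g := fun z => P a z 0) (by fun_prop) (by fun_prop) (m := 2 * a) (a := a) (fun z hz => by
        rw [hP0 a z hz]
        refine (hX.hasDerivAt_cross hY a hz).congr_of_eventuallyEq ?_
        filter_upwards [isOpen_ne.mem_nhds hz] with w hw
        rw [hP0 a w hw, hP0 (a + 1) w hw]
        rfl) l
    have h2 := id_sub_smul_adjoint_tailOp_ofCont (G := fun z => P (a + 1) z 1)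
      (g := fun z => P a z 1) (by fun_prop) (by fun_prop) (m := 2 * a + 1) (a := a) (fun z hz => by
        rw [hP0 a z hz]
        refine (hX.hasDerivAt_diag hY a hz).congr_of_eventuallyEq ?_
        filter_upwards [isOpen_ne.mem_nhds hz] with w hw
        rw [hP0 a w hw, hP0 (a + 1) w hw]
        rfl) l
    rw [adjoint_T_succ', ih, adjoint_S_vec, adjoint_S₁_succ, adjoint_S₂_succ, h1, h2]
    exact congrArg₂ vec (neg_neg _) (neg_neg _)

lemma adjoint_T_sinCos (a : ℕ) (l : ℂ) : adjoint (T a) (sinCos l) =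
    vec (ofCont (fun x => Phi a (l * x) 0) (by have := continuous_Phi a; fun_prop))
      (ofCont (fun x => Phi a (l * x) 1) (by have := continuous_Phi a; fun_prop)) := by
  refine adjoint_T_eq isRiccatiBessel_sphJ isRiccatiBessel_sphJ continuous_Phi
    (fun a z hz => Phi_of_ne a hz) l ?_ a
  refine congrArg₂ vec (ofCont_congr fun x _ => ?_) (ofCont_congr fun x _ => ?_) <;>
    simp [Phi_zero, mul_assoc]

lemma adjoint_T_cosNegSin (a : ℕ) (l : ℂ) : adjoint (T a) (cosNegSin l) =
    vec (ofCont (fun x => Psi a (l * x) 0) (by have := continuous_Psi a; fun_prop))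
      (ofCont (fun x => Psi a (l * x) 1) (by have := continuous_Psi a; fun_prop)) := by
  refine adjoint_T_eq isRiccatiBessel_sphEta isRiccatiBessel_sphJ continuous_Psi
    (fun a z hz => Psi_of_ne a hz) l ?_ a
  refine congrArg₂ vec (ofCont_congr fun x _ => ?_) (ofCont_congr fun x _ => ?_) <;>
    simp [Psi_zero, mul_assoc]

lemma vec_ofCont_ae {P : ℝ → Fin 2 → ℂ} {F : H} (h0 : Continuous fun x => P x 0)
    (h1 : Continuous fun x => P x 1)
    (hF : F = vec (ofCont (fun x => P x 0) h0) (ofCont (fun x => P x 1) h1)) :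
    ∀ᵐ x ∂μ01, P x = ![F.fst x, F.snd x] := by
  subst hF
  filter_upwards [ofCont_ae _ h0, ofCont_ae _ h1] with x hx0 hx1
  funext i
  fin_cases i
  · exact hx0.symm
  · exact hx1.symm

/-! ### Integral transforms -/

lemma integral_dotProduct {P : ℝ → Fin 2 → ℂ} (hP0 : Continuous fun x => P x 0)
    (hP1 : Continuous fun x => P x 1) (F : H)
    (h0 : Continuous fun x => (starRingEnd ℂ) (P x 0))
    (h1 : Continuous fun x => (starRingEnd ℂ) (P x 1)) :
    IntervalIntegrable (fun t => P t ⬝ᵥ ![F.fst t, F.snd t]) volume 0 1 ∧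
    ∫ t in (0:ℝ)..1, P t ⬝ᵥ ![F.fst t, F.snd t] =
      inner ℂ (vec (ofCont _ h0) (ofCont _ h1)) F := by
  have i0 := integrable_continuous_mul hP0 (integrable_coeFn F.fst)
  have i1 := integrable_continuous_mul hP1 (integrable_coeFn F.snd)
  have e : (fun t => P t ⬝ᵥ ![F.fst t, F.snd t]) =
      fun t => P t 0 * F.fst t + P t 1 * F.snd t := by
    funext t
    simp [dotProduct, Fin.sum_univ_two]
  constructor
  · rw [intervalIntegrable_iff_integrableOn_Ioo_of_le zero_le_one, e]
    exact i0.add i1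
  · rw [← integral_μ01, e, integral_add i0 i1, WithLp.prod_inner_apply]
    simp only [inner_ofCont_left, Complex.conj_conj]
    rfl

lemma integral_dotProduct_eq {P Q : ℝ → Fin 2 → ℂ} (hP : Continuous P) (hQ : Continuous Q)
    {A : H →L[ℂ] H} {U V : H} (h : adjoint A U = V)
    (hU : U = vec (ofCont (fun x => (starRingEnd ℂ) (Q x 0)) (Complex.continuous_conj.comp
      (by fun_prop))) (ofCont (fun x => (starRingEnd ℂ) (Q x 1)) (Complex.continuous_conj.comp
      (by fun_prop))))
    (hV : V = vec (ofCont (fun x => (starRingEnd ℂ) (P x 0)) (Complex.continuous_conj.comp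
      (by fun_prop))) (ofCont (fun x => (starRingEnd ℂ) (P x 1)) (Complex.continuous_conj.comp
      (by fun_prop)))) (F : H) :
    IntervalIntegrable (fun t => P t ⬝ᵥ ![F.fst t, F.snd t]) volume 0 1 ∧
    ∫ t in (0:ℝ)..1, P t ⬝ᵥ ![F.fst t, F.snd t] =
      ∫ t in (0:ℝ)..1, Q t ⬝ᵥ ![(A F).fst t, (A F).snd t] := by
  obtain ⟨h1, h2⟩ := integral_dotProduct (P := P) (by fun_prop) (by fun_prop) F
    (Complex.continuous_conj.comp (by fun_prop)) (Complex.continuous_conj.comp (by fun_prop))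
  obtain ⟨-, h3⟩ := integral_dotProduct (P := Q) (by fun_prop) (by fun_prop) (A F)
    (Complex.continuous_conj.comp (by fun_prop)) (Complex.continuous_conj.comp (by fun_prop))
  refine ⟨h1, ?_⟩
  rw [h2, h3, ← hU, ← hV, ← h, ContinuousLinearMap.adjoint_inner_left]

lemma integral_Phi (a : ℕ) (F : H) (l : ℂ) :
    IntervalIntegrable (fun t : ℝ => Phi a (l * t) ⬝ᵥ ![F.fst t, F.snd t]) volume 0 1 ∧
    ∫ t in (0:ℝ)..1, Phi a (l * t) ⬝ᵥ ![F.fst t, F.snd t] =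
      ∫ t in (0:ℝ)..1, ![Complex.sin (2 * l * t), Complex.cos (2 * l * t)] ⬝ᵥ
        ![(T a F).fst t, (T a F).snd t] := by
  have hP := continuous_Phi a
  have h2 : (starRingEnd ℂ) 2 = 2 := Complex.conj_natCast 2
  have hc (x : ℝ) : (starRingEnd ℂ) l * x = (starRingEnd ℂ) (l * x) := by simp
  refine integral_dotProduct_eq (P := fun t : ℝ => Phi a (l * t)) (by fun_prop)
    (Q := fun t : ℝ => ![Complex.sin (2 * l * t), Complex.cos (2 * l * t)])
    (continuous_pi fun i => by fin_cases i <;> dsimp <;> fun_prop)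
    -- The inner product conjugates its first argument, whereas the integrals are bilinear. The
    -- adjoint formula is therefore used at the conjugate of `l`, and all functions involved commute
    -- with conjugation.
    (adjoint_T_sinCos a ((starRingEnd ℂ) l)) ?_ ?_ F
  · refine congrArg₂ vec (ofCont_congr fun x _ => ?_) (ofCont_congr fun x _ => ?_)
    · simp [← Complex.sin_conj, h2]
    · simp [← Complex.cos_conj, h2]
  · refine congrArg₂ vec (ofCont_congr fun x _ => ?_) (ofCont_congr fun x _ => ?_) <;>
      rw [hc, Phi_conj]

lemma integral_Psi (a : ℕ) (F : H) (l : ℂ) :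
    IntervalIntegrable (fun t : ℝ => Psi a (l * t) ⬝ᵥ ![F.fst t, F.snd t]) volume 0 1 ∧
    ∫ t in (0:ℝ)..1, Psi a (l * t) ⬝ᵥ ![F.fst t, F.snd t] =
      ∫ t in (0:ℝ)..1, ![Complex.cos (2 * l * t), -Complex.sin (2 * l * t)] ⬝ᵥ
        ![(T a F).fst t, (T a F).snd t] := by
  have hP := continuous_Psi a
  have h2 : (starRingEnd ℂ) 2 = 2 := Complex.conj_natCast 2
  have hc (x : ℝ) : (starRingEnd ℂ) l * x = (starRingEnd ℂ) (l * x) := by simp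
  refine integral_dotProduct_eq (P := fun t : ℝ => Psi a (l * t)) (by fun_prop)
    (Q := fun t : ℝ => ![Complex.cos (2 * l * t), -Complex.sin (2 * l * t)])
    (continuous_pi fun i => by fin_cases i <;> dsimp <;> fun_prop)
    (adjoint_T_cosNegSin a ((starRingEnd ℂ) l)) ?_ ?_ F
  · refine congrArg₂ vec (ofCont_congr fun x _ => ?_) (ofCont_congr fun x _ => ?_)
    · simp [← Complex.cos_conj, h2]
    · simp [← Complex.sin_conj, h2]
  · refine congrArg₂ vec (ofCont_congr fun x _ => ?_) (ofCont_congr fun x _ => ?_) <;>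
      rw [hc, Psi_conj]

end

end AKNS

theorem mainTheorem10 (a : ℕ) :
    -- `T_a` acts diagonally, is bounded and one-to-one
    (∀ f g : AKNS.L2C, AKNS.T a (AKNS.vec f g) = AKNS.vec (AKNS.T₁ a f) (AKNS.T₂ a g)) ∧
    (∃ C : ℝ, ∀ F : AKNS.H, ‖AKNS.T a F‖ ≤ C * ‖F‖) ∧
    Function.Injective (AKNS.T a) ∧
    -- it turns Bessel integrals into trigonometric ones
    (∀ (p q : AKNS.L2C) (l : ℂ),
      IntervalIntegrable (fun t : ℝ => AKNS.Phi a (l * t) ⬝ᵥ ![p t, q t]) volume 0 1 ∧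
      ∫ t in (0:ℝ)..1, AKNS.Phi a (l * t) ⬝ᵥ ![p t, q t] =
        ∫ t in (0:ℝ)..1, ![Complex.sin (2 * l * t), Complex.cos (2 * l * t)] ⬝ᵥ
          ![(AKNS.T a (AKNS.vec p q)).fst t, (AKNS.T a (AKNS.vec p q)).snd t]) ∧
    (∀ (p q : AKNS.L2C) (l : ℂ),
      IntervalIntegrable (fun t : ℝ => AKNS.Psi a (l * t) ⬝ᵥ ![p t, q t]) volume 0 1 ∧
      ∫ t in (0:ℝ)..1, AKNS.Psi a (l * t) ⬝ᵥ ![p t, q t] =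
        ∫ t in (0:ℝ)..1, ![Complex.cos (2 * l * t), -Complex.sin (2 * l * t)] ⬝ᵥ
          ![(AKNS.T a (AKNS.vec p q)).fst t, (AKNS.T a (AKNS.vec p q)).snd t]) ∧
    -- the adjoint: components, action on the trigonometric vectors, kernel
    (∀ f g : AKNS.L2C, ContinuousLinearMap.adjoint (AKNS.T a) (AKNS.vec f g) =
      AKNS.vec (ContinuousLinearMap.adjoint (AKNS.T₁ a) f)
        (ContinuousLinearMap.adjoint (AKNS.T₂ a) g)) ∧
    (∀ l : ℂ, ∀ᵐ x : ℝ ∂AKNS.μ01, AKNS.Phi a (l * x) =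
      ![(ContinuousLinearMap.adjoint (AKNS.T a) (AKNS.sinCos l)).fst x,
        (ContinuousLinearMap.adjoint (AKNS.T a) (AKNS.sinCos l)).snd x]) ∧
    (∀ l : ℂ, ∀ᵐ x : ℝ ∂AKNS.μ01, AKNS.Psi a (l * x) =
      ![(ContinuousLinearMap.adjoint (AKNS.T a) (AKNS.cosNegSin l)).fst x,
        (ContinuousLinearMap.adjoint (AKNS.T a) (AKNS.cosNegSin l)).snd x]) ∧
    iSupIndep (fun k : Finset.Icc 1 a => AKNS.N k) ∧
    (ContinuousLinearMap.adjoint (AKNS.T a)).ker =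
      (⨆ k : Finset.Icc 1 a, AKNS.N k) ∧
    -- `T_a` is an isomorphism onto the orthogonal complement, with inverse `B_a`
    (∃ e : AKNS.H ≃L[ℂ] ↥(⨆ k : Finset.Icc 1 a, AKNS.N k)ᗮ,
      (∀ F : AKNS.H, (e F : AKNS.H) = AKNS.T a F) ∧
      ∀ G : ↥(⨆ k : Finset.Icc 1 a, AKNS.N k)ᗮ, e.symm G = AKNS.B a G) := by
  have hPhi := AKNS.continuous_Phi a
  have hPsi := AKNS.continuous_Psi a
  refine ⟨AKNS.T_vec a, ⟨‖AKNS.T a‖, (AKNS.T a).le_opNorm⟩, AKNS.T_injective a,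
    fun p q l => AKNS.integral_Phi a (AKNS.vec p q) l,
    fun p q l => AKNS.integral_Psi a (AKNS.vec p q) l, AKNS.adjoint_T_vec a, fun l => ?_,
    fun l => ?_, AKNS.iSupIndep_N a, AKNS.ker_adjoint_T a, AKNS.exists_equiv a⟩
  · exact AKNS.vec_ofCont_ae (P := fun x : ℝ => AKNS.Phi a (l * x)) (by fun_prop) (by fun_prop)
      (AKNS.adjoint_T_sinCos a l)
  · exact AKNS.vec_ofCont_ae (P := fun x : ℝ => AKNS.Psi a (l * x)) (by fun_prop) (by fun_prop)
      (AKNS.adjoint_T_cosNegSin a l)
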